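/- Let $K$ be a field. Work with binary quadratic symmetric operads over $K$ with finitely many generators, i.e. with $\mathcal{P}=\mathcal{F}(E)/(R)$, where $E=\mathcal{P}(2)$ is a finite-dimensional representation of $S_2$ and $R\subset\mathcal{F}(E)(3)$ is an $S_3$-invariant subspace; a morphism is an equivariant linear map of generators sending relators to relators. The Manin black product $\mathcal{P}\bullet\mathcal{Q}$ of $\mathcal{P}=\mathcal{F}(E)/(R)$ and $\mathcal{Q}=\mathcal{F}(F)/(S)$ has generators $E\otimes F\otimes\mathrm{sgn}_2$ and space of relators $\Psi(R\otimes S)$, where $\Psi:\mathcal{F}(E)(3)\otimes\mathcal{F}(F)(3)\otimes\mathrm{sgn}_3\to\mathcal{F}(E\otimes F\otimes\mathrm{sgn}_2)(3)$ is the canonical projection. For a vector space $V$ let $C^*(\Delta_1;V)$ be the complex of non-degenerate cochains on the $1$-simplex with left vertex $v_l$ and right vertex $v_r$; write ${}_x\!\to_y$ for the $0$-cochain with values $x$ at $v_l$ and $y$ at $v_r$ (zero values are omitted) and $\xrightarrow{x}$ for the $1$-cochain with value $x$, so $d({}_x\!\to_y)=\xrightarrow{y-x}$. An $\mathrm{Ass}_\bullet(\mathcal{P})$-algebra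 structure on $V$ is a dg $\mathcal{P}$-algebra structure on $C^*(\Delta_1;V)$ for which $C^*(\Delta_1,X;V)$ is a dg ideal for every set $X$ of vertices. Its associated $\mathcal{P}$-algebra structure on $V$ is given by $\to_x\cdot'\to_y\,=\,\to_{x\cdot y}$, for every generating product. A $\mathrm{Com}_\bullet(\mathcal{P})$-algebra is an $\mathrm{Ass}_\bullet(\mathcal{P})$-algebra whose associated $\mathcal{P}$-algebra is trivial. A $\mathrm{preLie}_\bullet(\mathcal{P})$-algebra structure on $V$ is a dg $\mathcal{P}$-algebra structure on $C^*(\Delta_1,v_l;V)$. Homomorphisms are the linear maps $V\to W$ which induce homomorphisms on cochains. Two operads are identified when their structures on every vector space correspond bijectively, with the same homomorphisms. Let $\mathcal{L}eib$ be the operad of right Leibniz algebras, with one product $\cdot$ and the relation $(x\cdot y)\cdot z=x\cdot(y\cdot z)+(x\cdot z)\cdot y$. For its generating product $\cdot'$ on cochains, define products on $V$ by $\xrightarrow{x\prec y}={}_x\!\to\cdot'\xrightarrow{y}$ for $\mathrm{Ass}_\bullet$, by $\xrightarrow{x\prec y}=\xrightarrow{x}\cdot'\to_y$ for $\mathrm{preLie}_\bullet$,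 and by $\xrightarrow{x\succ y}=-\,(\to_y\cdot'\xrightarrow{x})$ in both cases. Then: 1. $\mathrm{Ass}_\bullet(\mathcal{L}eib)=di\mathcal{A}ss$, the operad of diassociative algebras, with products $\prec,\succ$ and relations $$(x\prec y)\prec z=x\prec(y\prec z)=x\prec(y\succ z),\quad (x\succ y)\prec z=x\succ(y\prec z),\quad (x\prec y)\succ z=(x\succ y)\succ z=x\succ(y\succ z).$$ 2. $\mathrm{Com}_\bullet(\mathcal{L}eib)=\mathcal{P}erm$, the operad of right permutative algebras, with one product $x\star y=x\prec y=y\succ x$ and relations $(x\star y)\star z=x\star(y\star z)=x\star(z\star y)$. 3. $\mathrm{preLie}_\bullet(\mathcal{L}eib)$ is the operad generated by products $\prec,\succ$ (without symmetry) with the relations, where $x\cdot y=x\prec y-y\succ x$, $$x\prec(y\cdot z)=(x\prec y)\prec z-(x\prec z)\prec y,\quad (x\succ y)\succ z=(x\prec y)\succ z,\quad x\succ(y\cdot z)=(x\succ y)\prec z-(x\prec z)\succ y;$$ these generate the same space of relators as $$(x\prec y)\prec z-(x\prec z)\prec y-x\prec(y\cdot z),\quad -(y\succ x)\prec z+(y\prec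 z)\succ x+y\succ(x\cdot z),\quad -z\succ(x\cdot y)-(z\succ y)\succ x+(z\succ x)\prec y .$$ 4. The bottom row of Chapoton's square is the Manin black product of the middle row with $\mathcal{L}eib$: there are isomorphisms of operads $\mathcal{L}ie\bullet\mathcal{L}eib\cong\mathcal{L}eib$, $\mathcal{A}ss\bullet\mathcal{L}eib\cong di\mathcal{A}ss$ and $\mathcal{C}om\bullet\mathcal{L}eib\cong\mathcal{P}erm$ which carry the black product with $\mathcal{L}eib$ of the maps $\mathcal{L}ie\to\mathcal{A}ss\to\mathcal{C}om$ (namely $[x,y]\mapsto xy-yx$, and the product to the product) to the maps $\mathcal{L}eib\to di\mathcal{A}ss\to\mathcal{P}erm$ (namely $x\cdot y\mapsto x\prec y-y\succ x$, and $x\prec y\mapsto x\star y$, $x\succ y\mapsto y\star x$). -/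

import Mathlib

open CategoryTheory
open scoped TensorProduct

universe u v

noncomputable section

namespace BinaryOperad

/-! ### Binary quadratic operads

A binary quadratic (symmetric) operad over `K` is `𝓕(E)/(R)`, where `E` is a finite-dimensional
representation of the symmetric group on two letters and `R` is an invariant subspace of the arity
three component `𝓕(E)(3)` of the free operad. Both are determined by the operad, and a morphism of
such operads is the same thing as an equivariant linear map of the generators which sends relators
to relators. -/

section Trees

variable (K : Type u) [Field K] {E F : Type*} [AddCommGroup E] [Module K E]
  [AddCommGroup F] [Module K F]

variable (E) in
/-- The space `𝓕(E)(3)`: it is the direct sum of three copies of `E ⊗ E`. The vector `μ ⊗ ν` in the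
copy of index `u` (an integer modulo `3`) is the operation
`(x₀, x₁, x₂) ↦ μ (ν (x_u, x_{u+1}), x_{u+2})`. -/
abbrev Trees : Type _ := Fin 3 → E ⊗[K] E

variable (E) in
/-- The action of a three-cycle on `𝓕(E)(3)`. -/
def rot : Trees K E →ₗ[K] Trees K E :=
  LinearMap.pi fun u => LinearMap.proj (u + 1)

/-- The action on `𝓕(E)(3)` of the transposition which exchanges `x₀` and `x₁`; here `τ` is the
action of the transposition on `E`. -/
def swap (τ : E →ₗ[K] E) : Trees K E →ₗ[K] Trees K E :=
  LinearMap.pi fun u => LinearMap.lTensor E τ ∘ₗ LinearMap.proj (-u)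

/-- Invariance under the symmetric group on three letters. -/
def IsStable (τ : E →ₗ[K] E) (R : Submodule K (Trees K E)) : Prop :=
  ∀ a ∈ R, rot K E a ∈ R ∧ swap K τ a ∈ R

/-- The smallest invariant subspace that contains `s`. -/
def relClosure (τ : E →ₗ[K] E) (s : Set (Trees K E)) : Submodule K (Trees K E) :=
  sInf {R | IsStable K τ R ∧ s ⊆ R}

theorem relClosure_stable (τ : E →ₗ[K] E) (s : Set (Trees K E)) :
    IsStable K τ (relClosure K τ s) := by
  intro a ha
  simp only [relClosure, Submodule.mem_sInf, Set.mem_ofPred_eq] at ha ⊢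
  exact ⟨fun R hR => (hR.1 a (ha R hR)).1, fun R hR => (hR.1 a (ha R hR)).2⟩

theorem subset_relClosure (τ : E →ₗ[K] E) (s : Set (Trees K E)) :
    s ⊆ relClosure K τ s := by
  intro a ha
  simp only [relClosure, SetLike.mem_coe, Submodule.mem_sInf, Set.mem_ofPred_eq]
  exact fun R hR => hR.2 ha

theorem relClosure_le (τ : E →ₗ[K] E) (s : Set (Trees K E)) (R : Submodule K (Trees K E))
    (hR : IsStable K τ R) (hs : s ⊆ R) : relClosure K τ s ≤ R :=
  sInf_le ⟨hR, hs⟩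

/-- The tree monomial `(x_i ν x_j) μ x_k`, for `(i, j, k)` a permutation of `(0, 1, 2)`
(so that `k` is determined by `i` and `j`). -/
def leftComb (τ : E →ₗ[K] E) (ν μ : E) (i j _k : Fin 3) : Trees K E :=
  if j = i + 1 then Pi.single i (μ ⊗ₜ ν) else Pi.single j (μ ⊗ₜ τ ν)

/-- The tree monomial `x_i μ (x_j ν x_k)`, for `(i, j, k)` a permutation of `(0, 1, 2)`. -/
def rightComb (τ : E →ₗ[K] E) (μ ν : E) (i j k : Fin 3) : Trees K E :=
  leftComb K τ ν (τ μ) j k i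

/-- The map `𝓕(E)(3) → 𝓕(F)(3)` induced by a linear map `E → F`. -/
def mapTrees (f : E →ₗ[K] F) : Trees K E →ₗ[K] Trees K F :=
  LinearMap.pi fun u => TensorProduct.map f f ∘ₗ LinearMap.proj u

end Trees

/-- A binary quadratic operad: the representation `E` of operations of arity two, with the action
`τ` of the transposition, and the invariant space of quadratic relators. -/
structure BinQuad (K : Type u) [Field K] where
  E : Type u
  [addCommGroup : AddCommGroup E]
  [module : Module K E]
  [finite : Module.Finite K E]
  τ : E →ₗ[K] E
  τ_τ : ∀ e, τ (τ e) = e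
  rel : Submodule K (Trees K E)
  stable : IsStable K τ rel

attribute [instance] BinQuad.addCommGroup BinQuad.module BinQuad.finite

variable {K : Type u} [Field K]

/-- A morphism of binary quadratic operads. -/
@[ext]
structure BinQuad.Hom (P Q : BinQuad K) where
  toLin : P.E →ₗ[K] Q.E
  comm : ∀ e, toLin (P.τ e) = Q.τ (toLin e)
  map_rel : ∀ a ∈ P.rel, mapTrees K toLin a ∈ Q.rel

theorem mapTrees_id {E : Type*} [AddCommGroup E] [Module K E] (a : Trees K E) :
    mapTrees K (LinearMap.id : E →ₗ[K] E) a = a := by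
  ext u; simp [mapTrees]

theorem mapTrees_comp {E F G : Type*} [AddCommGroup E] [Module K E] [AddCommGroup F] [Module K F]
    [AddCommGroup G] [Module K G] (f : E →ₗ[K] F) (g : F →ₗ[K] G) (a : Trees K E) :
    mapTrees K (g ∘ₗ f) a = mapTrees K g (mapTrees K f a) := by
  ext u; simp [mapTrees, TensorProduct.map_comp]

instance : Category (BinQuad K) where
  Hom P Q := BinQuad.Hom P Q
  id P := ⟨LinearMap.id, fun _ => rfl, fun a ha => by rwa [mapTrees_id]⟩
  comp f g := ⟨g.toLin ∘ₗ f.toLin, fun e => by simp [f.comm, g.comm], fun a ha => by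
    rw [mapTrees_comp]; exact g.map_rel _ (f.map_rel _ ha)⟩

theorem mapTrees_rot {E F : Type*} [AddCommGroup E] [Module K E] [AddCommGroup F] [Module K F]
    (f : E →ₗ[K] F) (a : Trees K E) :
    mapTrees K f (rot K E a) = rot K F (mapTrees K f a) := by
  ext u; simp [mapTrees, rot]

theorem mapTrees_swap {E F : Type*} [AddCommGroup E] [Module K E] [AddCommGroup F] [Module K F]
    (τ : E →ₗ[K] E) (τ' : F →ₗ[K] F) (f : E →ₗ[K] F) (hf : ∀ e, f (τ e) = τ' (f e))
    (a : Trees K E) :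
    mapTrees K f (swap K τ a) = swap K τ' (mapTrees K f a) := by
  ext u
  simp only [mapTrees, swap, LinearMap.pi_apply, LinearMap.comp_apply, LinearMap.proj_apply]
  induction a (-u) using TensorProduct.induction_on with
  | zero => simp
  | tmul x y => simp [hf]
  | add x y hx hy => simp only [map_add, hx, hy]

/-- The operad with given generators and given generating relators. -/
@[simps E τ rel]
def BinQuad.present (E : Type u) [AddCommGroup E] [Module K E] [Module.Finite K E]
    (τ : E →ₗ[K] E) (hτ : ∀ e, τ (τ e) = e) (s : Set (Trees K E)) : BinQuad K where
  E := E
  τ := τ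
  τ_τ := hτ
  rel := relClosure K τ s
  stable := relClosure_stable K τ s

/-- A morphism out of a presented operad, given on generators. -/
def BinQuad.homMk {E : Type u} [AddCommGroup E] [Module K E] [Module.Finite K E]
    {τ : E →ₗ[K] E} {hτ : ∀ e, τ (τ e) = e} {s : Set (Trees K E)} {Q : BinQuad K}
    (f : E →ₗ[K] Q.E) (hf : ∀ e, f (τ e) = Q.τ (f e))
    (hs : ∀ a ∈ s, mapTrees K f a ∈ Q.rel) : BinQuad.present E τ hτ s ⟶ Q where
  toLin := f
  comm := hf
  map_rel := by
    intro a ha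
    refine relClosure_le K τ s (Q.rel.comap (mapTrees K f)) ?_ hs ha
    intro b hb
    simp only [Submodule.mem_comap] at hb ⊢
    rw [mapTrees_rot, mapTrees_swap τ Q.τ f hf]
    exact Q.stable _ hb

/-! ### The Manin black product -/

/-- The pairing `Ψ : 𝓕(E)(3) ⊗ 𝓕(F)(3) ⊗ sgn → 𝓕(E ⊗ F ⊗ sgn)(3)`, which sends
`(μ ⊗ ν)_u ⊗ (μ' ⊗ ν')_w` to `((μ ⊗ μ') ⊗ (ν ⊗ ν'))_u` if `u = w` and to zero otherwise. -/
def blackPairing (E F : Type*) [AddCommGroup E] [Module K E] [AddCommGroup F] [Module K F] :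
    Trees K E →ₗ[K] Trees K F →ₗ[K] Trees K (E ⊗[K] F) :=
  LinearMap.mk₂ K (fun a b u => TensorProduct.tensorTensorTensorComm K E E F F (a u ⊗ₜ b u))
    (fun a a' b => by ext u; simp [TensorProduct.add_tmul])
    (fun c a b => by ext u; simp only [Pi.smul_apply, ← TensorProduct.smul_tmul', map_smul])
    (fun a b b' => by ext u; simp [TensorProduct.tmul_add])
    (fun c a b => by ext u; simp)

theorem blackPairing_rot {E F : Type*} [AddCommGroup E] [Module K E] [AddCommGroup F] [Module K F]
    (a : Trees K E) (b : Trees K F) :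
    rot K _ (blackPairing E F a b) = blackPairing E F (rot K _ a) (rot K _ b) := by
  ext u; simp [blackPairing, rot]

theorem blackPairing_swap {E F : Type*} [AddCommGroup E] [Module K E] [AddCommGroup F]
    [Module K F] (τ : E →ₗ[K] E) (σ : F →ₗ[K] F) (a : Trees K E) (b : Trees K F) :
    swap K (-TensorProduct.map τ σ) (blackPairing E F a b)
      = -blackPairing E F (swap K τ a) (swap K σ b) := by
  ext u
  simp only [blackPairing, swap, LinearMap.pi_apply, LinearMap.comp_apply, LinearMap.proj_apply,
    LinearMap.mk₂_apply, Pi.neg_apply]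
  induction a (-u) using TensorProduct.induction_on with
  | zero => simp
  | add x y hx hy => simp only [map_add, TensorProduct.add_tmul, hx, hy, neg_add]
  | tmul x y =>
    induction b (-u) using TensorProduct.induction_on with
    | zero => simp
    | add x y hx hy => simp only [map_add, TensorProduct.tmul_add, hx, hy, neg_add]
    | tmul z w => simp

/-- The Manin black product `P ● Q`: its generators are `P(2) ⊗ Q(2) ⊗ sgn`, and its space of
relators is the image under `Ψ` of the tensor product of the spaces of relators. -/
def black (P Q : BinQuad K) : BinQuad K where
  E := P.E ⊗[K] Q.E
  τ := -TensorProduct.map P.τ Q.τ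
  τ_τ e := by
    induction e using TensorProduct.induction_on with
    | zero => simp
    | add x y hx hy => simp only [map_add, hx, hy]
    | tmul x y => simp [P.τ_τ, Q.τ_τ]
  rel := Submodule.map₂ (blackPairing P.E Q.E) P.rel Q.rel
  stable := by
    have h₁ : Submodule.map₂ (blackPairing P.E Q.E) P.rel Q.rel ≤
        (Submodule.map₂ (blackPairing P.E Q.E) P.rel Q.rel).comap (rot K _) := by
      refine Submodule.map₂_le.2 fun a ha b hb => ?_
      rw [Submodule.mem_comap, blackPairing_rot]
      exact Submodule.apply_mem_map₂ _ (P.stable a ha).1 (Q.stable b hb).1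
    have h₂ : Submodule.map₂ (blackPairing P.E Q.E) P.rel Q.rel ≤
        (Submodule.map₂ (blackPairing P.E Q.E) P.rel Q.rel).comap
          (swap K (-TensorProduct.map P.τ Q.τ)) := by
      refine Submodule.map₂_le.2 fun a ha b hb => ?_
      rw [Submodule.mem_comap, blackPairing_swap]
      exact Submodule.neg_mem _ (Submodule.apply_mem_map₂ _ (P.stable a ha).2 (Q.stable b hb).2)
    exact fun c hc => ⟨h₁ hc, h₂ hc⟩

theorem mapTrees_blackPairing {E E' F : Type*} [AddCommGroup E] [Module K E] [AddCommGroup E']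
    [Module K E'] [AddCommGroup F] [Module K F] (f : E →ₗ[K] E') (a : Trees K E) (b : Trees K F) :
    mapTrees K (LinearMap.rTensor F f) (blackPairing E F a b)
      = blackPairing E' F (mapTrees K f a) b := by
  ext u
  simp only [blackPairing, mapTrees, LinearMap.pi_apply, LinearMap.comp_apply,
    LinearMap.proj_apply, LinearMap.mk₂_apply]
  induction a u using TensorProduct.induction_on with
  | zero => simp
  | add x y hx hy => simp only [map_add, TensorProduct.add_tmul, hx, hy]
  | tmul x y =>
    induction b u using TensorProduct.induction_on with
    | zero => simp
    | add x y hx hy => simp only [map_add, TensorProduct.tmul_add, hx, hy]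
    | tmul z w => simp

/-- Functoriality `P ● Q → P' ● Q` of the black product in its first argument. -/
def blackMap {P P' : BinQuad K} (f : P ⟶ P') (Q : BinQuad K) : black P Q ⟶ black P' Q where
  toLin := LinearMap.rTensor Q.E f.toLin
  comm e := by
    have h : LinearMap.rTensor Q.E f.toLin ∘ₗ (-TensorProduct.map P.τ Q.τ)
        = (-TensorProduct.map P'.τ Q.τ) ∘ₗ LinearMap.rTensor Q.E f.toLin := by
      ext x y; simp [f.comm]
    exact LinearMap.congr_fun h e
  map_rel := by
    have h : Submodule.map₂ (blackPairing P.E Q.E) P.rel Q.rel ≤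
        (Submodule.map₂ (blackPairing P'.E Q.E) P'.rel Q.rel).comap
          (mapTrees K (LinearMap.rTensor Q.E f.toLin)) := by
      refine Submodule.map₂_le.2 fun a ha b hb => ?_
      rw [Submodule.mem_comap, mapTrees_blackPairing]
      exact Submodule.apply_mem_map₂ _ (f.map_rel a ha) hb
    exact fun c hc => h hc

/-! ### Algebras and dg algebras over a binary quadratic operad -/

/-- For a family of products `m e`, the value of the trees of index `i` at `x`: it sends `μ ⊗ ν` to
`m μ (m ν (x_i, x_{i+1}), x_{i+2})`. -/
def evalTree {E A : Type*} [AddCommGroup E] [Module K E] [AddCommGroup A] [Module K A]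
    (m : E →ₗ[K] A →ₗ[K] A →ₗ[K] A) (x : Fin 3 → A) (i : Fin 3) : E ⊗[K] E →ₗ[K] A :=
  TensorProduct.lift <| LinearMap.mk₂ K (fun μ ν => m μ (m ν (x i) (x (i + 1))) (x (i + 2)))
    (by intros; simp) (by intros; simp) (by intros; simp) (by intros; simp)

/-- A structure of `P`-algebra on a vector space. -/
@[ext]
structure Alg (P : BinQuad K) (V : Type v) [AddCommGroup V] [Module K V] where
  op : P.E →ₗ[K] V →ₗ[K] V →ₗ[K] V
  op_swap : ∀ e x y, op (P.τ e) x y = op e y x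
  op_rel : ∀ a ∈ P.rel, ∀ x : Fin 3 → V, ∑ u, evalTree op x u (a u) = 0

/-- A non-negatively graded cochain complex of vector spaces, as an internally graded space. -/
structure DGMod (K : Type u) [Field K] where
  carrier : Type v
  [addCommGroup : AddCommGroup carrier]
  [module : Module K carrier]
  deg : ℕ → Submodule K carrier
  isInternal : DirectSum.IsInternal deg
  d : carrier →ₗ[K] carrier
  d_mem : ∀ i, ∀ x ∈ deg i, d x ∈ deg (i + 1)
  d_d : ∀ x, d (d x) = 0

attribute [instance] DGMod.addCommGroup DGMod.module

/-- The Koszul sign of the permutation `(x₀, x₁, x₂) ↦ (x_u, x_{u+1}, x_{u+2})` of homogeneous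
elements of degrees `i 0`, `i 1`, `i 2`. -/
def koszulSign (i : Fin 3 → ℕ) : Fin 3 → ℤ :=
  ![1, (-1) ^ (i 0 * (i 1 + i 2)), (-1) ^ (i 2 * (i 0 + i 1))]

/-- A structure of dg `P`-algebra on a complex (the products have degree zero). -/
@[ext]
structure DGAlg (P : BinQuad K) (A : DGMod.{u, v} K) where
  op : P.E →ₗ[K] A.carrier →ₗ[K] A.carrier →ₗ[K] A.carrier
  op_mem : ∀ e i j, ∀ x ∈ A.deg i, ∀ y ∈ A.deg j, op e x y ∈ A.deg (i + j)
  op_swap : ∀ e i j, ∀ x ∈ A.deg i, ∀ y ∈ A.deg j,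
    op (P.τ e) x y = (-1 : ℤ) ^ (i * j) • op e y x
  leibniz : ∀ e i, ∀ x ∈ A.deg i, ∀ y,
    A.d (op e x y) = op e (A.d x) y + (-1 : ℤ) ^ i • op e x (A.d y)
  op_rel : ∀ a ∈ P.rel, ∀ (i : Fin 3 → ℕ) (x : Fin 3 → A.carrier), (∀ k, x k ∈ A.deg (i k)) →
    ∑ u, koszulSign i u • evalTree op x u (a u) = 0

/-- A dg ideal: a subspace which is closed under the differential and absorbs all the products. -/
def DGAlg.IsIdeal {P : BinQuad K} {A : DGMod.{u, v} K} (S : DGAlg P A)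
    (I : Submodule K A.carrier) : Prop :=
  (∀ x ∈ I, A.d x ∈ I) ∧ ∀ e, ∀ x ∈ I, ∀ y, S.op e x y ∈ I ∧ S.op e y x ∈ I

/-! ### Cochains on the interval -/

section Cochains

/-- The grading of `C⁰ × C¹`. -/
def twoTermDeg (C₀ C₁ : Type v) [AddCommGroup C₀] [Module K C₀] [AddCommGroup C₁] [Module K C₁] :
    ℕ → Submodule K (C₀ × C₁)
  | 0 => LinearMap.range (LinearMap.inl K C₀ C₁)
  | 1 => LinearMap.range (LinearMap.inr K C₀ C₁)
  | _ + 2 => ⊥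

theorem twoTermDeg_isInternal (C₀ C₁ : Type v) [AddCommGroup C₀] [Module K C₀] [AddCommGroup C₁]
    [Module K C₁] : DirectSum.IsInternal (twoTermDeg (K := K) C₀ C₁) := by
  have hc := LinearMap.isCompl_range_inl_inr (R := K) (M := C₀) (M₂ := C₁)
  refine (DirectSum.isInternal_submodule_iff_iSupIndep_and_iSup_eq_top _).2 ⟨fun i => ?_, ?_⟩
  · match i with
    | 0 =>
      refine hc.disjoint.mono_right (iSup₂_le fun j hj => ?_)
      match j, hj with
      | 1, _ => exact le_rfl
      | _ + 2, _ => exact bot_le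
    | 1 =>
      refine hc.disjoint.symm.mono_right (iSup₂_le fun j hj => ?_)
      match j, hj with
      | 0, _ => exact le_rfl
      | _ + 2, _ => exact bot_le
    | _ + 2 => exact disjoint_bot_left
  · refine eq_top_iff.2 (hc.sup_eq_top.symm.le.trans (sup_le ?_ ?_))
    · exact le_iSup (twoTermDeg (K := K) C₀ C₁) 0
    · exact le_iSup (twoTermDeg (K := K) C₀ C₁) 1

/-- The complex `C⁰ → C¹` (in degrees zero and one). -/
def twoTerm {C₀ C₁ : Type v} [AddCommGroup C₀] [Module K C₀] [AddCommGroup C₁]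
    [Module K C₁] (δ : C₀ →ₗ[K] C₁) : DGMod.{u, v} K where
  carrier := C₀ × C₁
  deg := twoTermDeg C₀ C₁
  isInternal := twoTermDeg_isInternal C₀ C₁
  d := LinearMap.inr K C₀ C₁ ∘ₗ δ ∘ₗ LinearMap.fst K C₀ C₁
  d_mem i x hx := by
    match i, hx with
    | 0, _ => exact ⟨δ x.1, rfl⟩
    | 1, hx => obtain ⟨y, rfl⟩ := hx; exact Prod.ext rfl (map_zero δ)
    | n + 2, hx => obtain rfl := (Submodule.mem_bot K).1 hx; rw [map_zero]; exact zero_mem _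
  d_d x := by simp

variable (K) (V : Type v) [AddCommGroup V] [Module K V]

/-- The coboundary of a function on the vertices `0` (left) and `1` (right) of the interval. -/
def coboundary : (Fin 2 → V) →ₗ[K] V :=
  (LinearMap.proj 1 : (Fin 2 → V) →ₗ[K] V) - LinearMap.proj 0

/-- The functions on the set of vertices which vanish on `X`. -/
def vanishingOn (X : Set (Fin 2)) : Submodule K (Fin 2 → V) where
  carrier := {f | ∀ i ∈ X, f i = 0}
  add_mem' hf hg i hi := by simp [hf i hi, hg i hi]
  zero_mem' _ _ := rfl
  smul_mem' c f hf i hi := by simp [hf i hi]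

/-- The complex `C^*(Δ₁; V)` of non-degenerate cochains on the interval. -/
abbrev cochains : DGMod.{u, v} K := twoTerm (coboundary K V)

/-- The subcomplex `C^*(Δ₁, X; V)` of relative cochains, for a set `X` of vertices. -/
def relCochains (X : Set (Fin 2)) : Submodule K (cochains K V).carrier :=
  (vanishingOn K V X).prod ⊤

/-- The complex `C^*(Δ₁, v_l; V)` of cochains relative to the left vertex. -/
abbrev leftRelCochains : DGMod.{u, v} K :=
  twoTerm ((coboundary K V).domRestrict (vanishingOn K V {0}))

variable {V}

/-- The `0`-cochain with value `x` at the vertex `i` and zero at the other vertex. -/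
def vertexCochain (i : Fin 2) (x : V) : (cochains K V).carrier := (Pi.single i x, 0)

/-- The `1`-cochain with value `x`. -/
def edgeCochain (x : V) : (cochains K V).carrier := (0, x)

/-- The `0`-cochain relative to the left vertex, with value `x` at the right vertex. -/
def relVertexCochain (x : V) : (leftRelCochains K V).carrier :=
  (⟨Pi.single 1 x, by rintro i rfl; simp⟩, 0)

/-- The `1`-cochain with value `x`, as a cochain relative to the left vertex. -/
def relEdgeCochain (x : V) : (leftRelCochains K V).carrier := (0, x)

variable {W : Type v} [AddCommGroup W] [Module K W]

/-- The map of cochains induced by a linear map of coefficients. -/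
def cochainsMap (f : V →ₗ[K] W) : (cochains K V).carrier →ₗ[K] (cochains K W).carrier :=
  (f.compLeft (Fin 2)).prodMap f

/-- The map of cochains relative to the left vertex induced by a linear map of coefficients. -/
def leftRelCochainsMap (f : V →ₗ[K] W) :
    (leftRelCochains K V).carrier →ₗ[K] (leftRelCochains K W).carrier :=
  ((f.compLeft (Fin 2)).restrict (p := vanishingOn K V {0}) (q := vanishingOn K W {0})
    (fun g hg i hi => by simp [hg i hi])).prodMap f

end Cochains

/-! ### The constructions `Ass_●`, `Com_●` and `preLie_●` -/

/-- A type of algebras: structures on vector spaces, together with their homomorphisms. -/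
structure AlgType (K : Type u) [Field K] where
  Str : (V : Type v) → [AddCommGroup V] → [Module K V] → Type (max u v)
  IsHom : {V W : Type v} → [AddCommGroup V] → [Module K V] → [AddCommGroup W] → [Module K W] →
    Str V → Str W → (V →ₗ[K] W) → Prop

/-- An identification of two types of algebras: a bijection of the structures on every vector
space, which is natural, in that the homomorphisms are the same linear maps. -/
structure AlgType.Iso (S T : AlgType.{u, v} K) where
  equiv : (V : Type v) → [AddCommGroup V] → [Module K V] → S.Str V ≃ T.Str V
  isHom_iff : ∀ {V W : Type v} [AddCommGroup V] [Module K V] [AddCommGroup W] [Module K W]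
    (s : S.Str V) (t : S.Str W) (f : V →ₗ[K] W),
    S.IsHom s t f ↔ T.IsHom (equiv V s) (equiv W t) f

/-- The type of algebras of an operad. -/
def algType (P : BinQuad K) : AlgType.{u, v} K where
  Str V _ _ := Alg P V
  IsHom s t f := ∀ e x y, f (s.op e x y) = t.op e (f x) (f y)

/-- An `Ass_●(P)`-algebra structure on `V`: a local dg `P`-algebra structure on `C^*(Δ₁; V)`. -/
@[ext]
structure AssBulletStr (P : BinQuad K) (V : Type v) [AddCommGroup V] [Module K V] extends
    DGAlg P (cochains K V) where
  isLocal : ∀ X : Set (Fin 2), toDGAlg.IsIdeal (relCochains K V X)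

/-- The associated `P`-algebra of an `Ass_●(P)`-algebra: the product of `x` and `y` is the value at
the right vertex of the product of the `0`-cochains concentrated there with values `x` and `y`. -/
def AssBulletStr.assoc {P : BinQuad K} {V : Type v} [AddCommGroup V] [Module K V]
    (S : AssBulletStr P V) (e : P.E) (x y : V) : V :=
  (S.op e (vertexCochain K 1 x) (vertexCochain K 1 y)).1 1

/-- The product `x ≺ y` of an `Ass_●(P)`-algebra which corresponds to the operation `e` of `P`:
the product of the `0`-cochain `x` at the left vertex with the `1`-cochain `y`. -/
def AssBulletStr.prec {P : BinQuad K} {V : Type v} [AddCommGroup V] [Module K V]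
    (S : AssBulletStr P V) (e : P.E) (x y : V) : V :=
  (S.op e (vertexCochain K 0 x) (edgeCochain K y)).2

/-- The product `x ≻ y` of an `Ass_●(P)`-algebra which corresponds to the operation `e` of `P`:
the opposite of the product of the `0`-cochain `y` at the right vertex with the `1`-cochain `x`. -/
def AssBulletStr.succ {P : BinQuad K} {V : Type v} [AddCommGroup V] [Module K V]
    (S : AssBulletStr P V) (e : P.E) (x y : V) : V :=
  -(S.op e (vertexCochain K 1 y) (edgeCochain K x)).2

/-- The type of `Ass_●(P)`-algebras. -/
def assBullet (P : BinQuad K) : AlgType.{u, v} K where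
  Str V _ _ := AssBulletStr P V
  IsHom s t f := ∀ e x y,
    cochainsMap K f (s.op e x y) = t.op e (cochainsMap K f x) (cochainsMap K f y)

/-- A `Com_●(P)`-algebra structure: an `Ass_●(P)`-algebra structure whose associated `P`-algebra is
trivial. -/
@[ext]
structure ComBulletStr (P : BinQuad K) (V : Type v) [AddCommGroup V] [Module K V] extends
    AssBulletStr P V where
  assoc_eq_zero : ∀ e x y, toAssBulletStr.assoc e x y = 0

/-- The type of `Com_●(P)`-algebras. -/
def comBullet (P : BinQuad K) : AlgType.{u, v} K where
  Str V _ _ := ComBulletStr P V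
  IsHom s t f := (assBullet P).IsHom s.toAssBulletStr t.toAssBulletStr f

/-- A `preLie_●(P)`-algebra structure on `V`: a dg `P`-algebra structure on `C^*(Δ₁, v_l; V)`. -/
abbrev PreLieBulletStr (P : BinQuad K) (V : Type v) [AddCommGroup V] [Module K V] :
    Type (max u v) :=
  DGAlg P (leftRelCochains K V)

/-- The product `x ≺ y` of a `preLie_●(P)`-algebra: the product of the `1`-cochain `x` with the
`0`-cochain `y` at the right vertex. -/
def preLieBulletPrec {P : BinQuad K} {V : Type v} [AddCommGroup V] [Module K V]
    (S : PreLieBulletStr P V) (e : P.E) (x y : V) : V :=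
  (S.op e (relEdgeCochain K x) (relVertexCochain K y)).2

/-- The product `x ≻ y` of a `preLie_●(P)`-algebra: the opposite of the product of the `0`-cochain
`y` at the right vertex with the `1`-cochain `x`. -/
def preLieBulletSucc {P : BinQuad K} {V : Type v} [AddCommGroup V] [Module K V]
    (S : PreLieBulletStr P V) (e : P.E) (x y : V) : V :=
  -(S.op e (relVertexCochain K y) (relEdgeCochain K x)).2

/-- The type of `preLie_●(P)`-algebras. -/
def preLieBullet (P : BinQuad K) : AlgType.{u, v} K where
  Str V _ _ := PreLieBulletStr P V
  IsHom s t f := ∀ e x y, leftRelCochainsMap K f (s.op e x y)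
    = t.op e (leftRelCochainsMap K f x) (leftRelCochainsMap K f y)

/-! ### The operads -/

section Operads

variable (K)

/-- The representation spanned by `n` operations without symmetry and their opposites. -/
abbrev Gens (n : ℕ) : Type u := Fin n → K × K

/-- The transposition exchanges every operation with its opposite. -/
def opp (n : ℕ) : Gens K n →ₗ[K] Gens K n :=
  (LinearEquiv.prodComm K K K).toLinearMap.compLeft (Fin n)

/-- The `i`-th operation without symmetry. -/
def gen {n : ℕ} (i : Fin n) : Gens K n := Pi.single i (1, 0)

/-- The operad generated by `n` operations without symmetry, with given relators. -/
abbrev nonSymm (n : ℕ) (s : Set (Trees K (Gens K n))) : BinQuad K :=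
  BinQuad.present (Gens K n) (opp K n) (fun _ => rfl) s

variable {K} in
/-- `(x_i a x_j) b x_k` -/
def lm {n : ℕ} (a b : Gens K n) (i j k : Fin 3) : Trees K (Gens K n) :=
  leftComb K (opp K n) a b i j k

variable {K} in
/-- `x_i a (x_j b x_k)` -/
def rm {n : ℕ} (a b : Gens K n) (i j k : Fin 3) : Trees K (Gens K n) :=
  rightComb K (opp K n) a b i j k

/-- `(x y) z - x (y z)` -/
def assRel : Trees K (Gens K 1) :=
  lm (gen K 0) (gen K 0) 0 1 2 - rm (gen K 0) (gen K 0) 0 1 2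

/-- `(x y) z - x (y z) - (x z) y` -/
def leibRel : Trees K (Gens K 1) :=
  lm (gen K 0) (gen K 0) 0 1 2 - rm (gen K 0) (gen K 0) 0 1 2 - lm (gen K 0) (gen K 0) 0 2 1

/-- The operad of associative algebras. -/
def Ass : BinQuad K := nonSymm K 1 {assRel K}

/-- The operad of right Leibniz algebras. -/
def Leib : BinQuad K := nonSymm K 1 {leibRel K}

/-- The operad of right permutative algebras: `(x y) z = x (y z) = x (z y)`. -/
def PermOp : BinQuad K := nonSymm K 1
  {assRel K, rm (gen K 0) (gen K 0) 0 1 2 - rm (gen K 0) (gen K 0) 0 2 1}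

/-- The operad of commutative associative algebras. -/
def Com : BinQuad K := BinQuad.present K LinearMap.id (fun _ => rfl)
  {leftComb K LinearMap.id (1 : K) 1 0 1 2 - rightComb K LinearMap.id (1 : K) 1 0 1 2}

/-- The operad of Lie algebras: an antisymmetric bracket with `[[x,y],z]+[[y,z],x]+[[z,x],y]=0`. -/
def LieOp : BinQuad K := BinQuad.present K (-LinearMap.id) (fun e => by simp)
  {leftComb K (-LinearMap.id) (1 : K) 1 0 1 2 + leftComb K (-LinearMap.id) (1 : K) 1 1 2 0
    + leftComb K (-LinearMap.id) (1 : K) 1 2 0 1}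

/-- The diassociative relations, where `≺` and `≻` are the operations `0` and `1`:
`(x ≺ y) ≺ z = x ≺ (y ≺ z) = x ≺ (y ≻ z)`, `(x ≻ y) ≺ z = x ≻ (y ≺ z)`,
`(x ≺ y) ≻ z = (x ≻ y) ≻ z = x ≻ (y ≻ z)`. -/
def diAssRels : Set (Trees K (Gens K 2)) :=
  {lm (gen K 0) (gen K 0) 0 1 2 - rm (gen K 0) (gen K 0) 0 1 2,
   rm (gen K 0) (gen K 0) 0 1 2 - rm (gen K 0) (gen K 1) 0 1 2,
   lm (gen K 1) (gen K 0) 0 1 2 - rm (gen K 1) (gen K 0) 0 1 2,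
   lm (gen K 0) (gen K 1) 0 1 2 - lm (gen K 1) (gen K 1) 0 1 2,
   lm (gen K 1) (gen K 1) 0 1 2 - rm (gen K 1) (gen K 1) 0 1 2}

/-- The operad of diassociative algebras. -/
def DiAss : BinQuad K := nonSymm K 2 (diAssRels K)

/-- Relators, with `≺` and `≻` the operations `0` and `1` and `x · y = x ≺ y - y ≻ x`:
`(x ≺ y) ≺ z - (x ≺ z) ≺ y - x ≺ (y · z)`, `-(y ≻ x) ≺ z + (y ≺ z) ≻ x + y ≻ (x · z)` and
`-z ≻ (x · y) - (z ≻ y) ≻ x + (z ≻ x) ≺ y`. -/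
def preLieLeibRels : Set (Trees K (Gens K 2)) :=
  {lm (gen K 0) (gen K 0) 0 1 2 - lm (gen K 0) (gen K 0) 0 2 1
      - (rm (gen K 0) (gen K 0) 0 1 2 - rm (gen K 0) (gen K 1) 0 2 1),
   -lm (gen K 1) (gen K 0) 1 0 2 + lm (gen K 0) (gen K 1) 1 2 0
      + (rm (gen K 1) (gen K 0) 1 0 2 - rm (gen K 1) (gen K 1) 1 2 0),
   -(rm (gen K 1) (gen K 0) 2 0 1 - rm (gen K 1) (gen K 1) 2 1 0)
      - lm (gen K 1) (gen K 1) 2 1 0 + lm (gen K 1) (gen K 0) 2 0 1}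

/-- Relators, with `≺` and `≻` the operations `0` and `1` and `x · y = x ≺ y - y ≻ x`:
`x ≺ (y · z) = (x ≺ y) ≺ z - (x ≺ z) ≺ y`, `(x ≻ y) ≻ z = (x ≺ y) ≻ z` and
`x ≻ (y · z) = (x ≻ y) ≺ z - (x ≺ z) ≻ y`. -/
def preLieLeibRels' : Set (Trees K (Gens K 2)) :=
  {(rm (gen K 0) (gen K 0) 0 1 2 - rm (gen K 0) (gen K 1) 0 2 1)
      - (lm (gen K 0) (gen K 0) 0 1 2 - lm (gen K 0) (gen K 0) 0 2 1),
   lm (gen K 1) (gen K 1) 0 1 2 - lm (gen K 0) (gen K 1) 0 1 2,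
   (rm (gen K 1) (gen K 0) 0 1 2 - rm (gen K 1) (gen K 1) 0 2 1)
      - (lm (gen K 1) (gen K 0) 0 1 2 - lm (gen K 0) (gen K 1) 0 2 1)}

/-- The operad generated by two operations `≺`, `≻` without symmetry and `preLieLeibRels'`. -/
def PreLieLeib : BinQuad K := nonSymm K 2 (preLieLeibRels' K)

/-- The generating product of the operad `Leib`. -/
def leibDot : (Leib K).E := gen K 0

/-- The generating product of the operad `Perm`. -/
def permDot : (PermOp K).E := gen K 0

/-- The product `≺` of the operad `diAss`. -/
def diPrec : (DiAss K).E := gen K 0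

/-- The product `≻` of the operad `diAss`. -/
def diSucc : (DiAss K).E := gen K 1

/-- The product `≺` of the operad `PreLieLeib`. -/
def plPrec : (PreLieLeib K).E := gen K 0

/-- The product `≻` of the operad `PreLieLeib`. -/
def plSucc : (PreLieLeib K).E := gen K 1

variable {K} in
/-- The equivariant map which sends the `i`-th operation without symmetry to `c i`. -/
def gensLift {n : ℕ} {F : Type u} [AddCommGroup F] [Module K F] (σ : F →ₗ[K] F) (c : Fin n → F) :
    Gens K n →ₗ[K] F :=
  ∑ i, (((LinearMap.fst K K K).smulRight (c i) + (LinearMap.snd K K K).smulRight (σ (c i)))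
    ∘ₗ LinearMap.proj i)

variable {K} in
theorem gensLift_opp {n : ℕ} {F : Type u} [AddCommGroup F] [Module K F] (σ : F →ₗ[K] F)
    (hσ : ∀ e, σ (σ e) = e) (c : Fin n → F) (e : Gens K n) :
    gensLift σ c (opp K n e) = σ (gensLift σ c e) := by
  simp only [gensLift, LinearMap.sum_apply, map_sum]
  refine Finset.sum_congr rfl fun i _ => ?_
  simp [opp, hσ, add_comm]

end Operads

section Arrows

theorem mapTrees_leftComb {E F : Type*} [AddCommGroup E] [Module K E] [AddCommGroup F] [Module K F]
    (τ : E →ₗ[K] E) (σ : F →ₗ[K] F) (f : E →ₗ[K] F) (hf : ∀ e, f (τ e) = σ (f e)) (a b : E)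
    (i j k : Fin 3) :
    mapTrees K f (leftComb K τ a b i j k) = leftComb K σ (f a) (f b) i j k := by
  ext u
  unfold leftComb mapTrees
  split_ifs with h
  · rcases eq_or_ne u i with rfl | hu
    · simp
    · simp [hu]
  · rcases eq_or_ne u j with rfl | hu
    · simp [hf]
    · simp [hu]

theorem mapTrees_rightComb {E F : Type*} [AddCommGroup E] [Module K E] [AddCommGroup F]
    [Module K F] (τ : E →ₗ[K] E) (σ : F →ₗ[K] F) (f : E →ₗ[K] F) (hf : ∀ e, f (τ e) = σ (f e))
    (a b : E) (i j k : Fin 3) :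
    mapTrees K f (rightComb K τ a b i j k) = rightComb K σ (f a) (f b) i j k := by
  simp only [rightComb, mapTrees_leftComb τ σ f hf, hf]

theorem gensLift_gen {n : ℕ} {F : Type u} [AddCommGroup F] [Module K F] (σ : F →ₗ[K] F)
    (c : Fin n → F) (i : Fin n) : gensLift σ c (gen K i) = c i := by
  rw [gensLift, LinearMap.sum_apply, Finset.sum_eq_single i]
  · simp [gen]
  · intro j _ hj; simp [gen, hj]
  · simp

theorem neg_one_fin3 : (-1 : Fin 3) = 2 := rfl

theorem neg_two_fin3 : (-2 : Fin 3) = 1 := rfl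

theorem opp_opp {n : ℕ} (e : Gens K n) : opp K n (opp K n e) = e := rfl

theorem lieToAss_aux (Q : BinQuad K) (m : Q.E)
    (hm : leftComb K Q.τ m m 0 1 2 - rightComb K Q.τ m m 0 1 2 ∈ Q.rel)
    (f : K →ₗ[K] Q.E) (hf : ∀ e, f ((-LinearMap.id : K →ₗ[K] K) e) = Q.τ (f e))
    (h1 : f 1 = m - Q.τ m) :
    mapTrees K f (leftComb K (-LinearMap.id) (1 : K) 1 0 1 2
      + leftComb K (-LinearMap.id) (1 : K) 1 1 2 0
      + leftComb K (-LinearMap.id) (1 : K) 1 2 0 1) ∈ Q.rel := by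
  have hd := sub_mem hm (Q.stable _ hm).2
  have hM := add_mem (add_mem hd (Q.stable _ hd).1) (Q.stable _ (Q.stable _ hd).1).1
  simp only [map_add, mapTrees_leftComb _ Q.τ _ hf, h1]
  convert hM using 1
  ext u
  fin_cases u <;>
    simp [leftComb, rightComb, rot, swap, neg_one_fin3, neg_two_fin3, TensorProduct.tmul_sub,
      TensorProduct.sub_tmul] <;> abel

theorem assToCom_aux (Q : BinQuad K) (m : Q.E)
    (hm : leftComb K Q.τ m m 0 1 2 - rightComb K Q.τ m m 0 1 2 ∈ Q.rel)
    (f : Gens K 1 →ₗ[K] Q.E) (hf : ∀ e, f (opp K 1 e) = Q.τ (f e)) (h1 : f (gen K 0) = m) :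
    mapTrees K f (assRel K) ∈ Q.rel := by
  simpa only [assRel, lm, rm, map_sub, mapTrees_leftComb _ Q.τ _ hf,
    mapTrees_rightComb _ Q.τ _ hf, h1] using hm

theorem leibToDiAss_aux (Q : BinQuad K) (p s : Q.E)
    (h1 : leftComb K Q.τ p p 0 1 2 - rightComb K Q.τ p p 0 1 2 ∈ Q.rel)
    (h2 : rightComb K Q.τ p p 0 1 2 - rightComb K Q.τ p s 0 1 2 ∈ Q.rel)
    (h3 : leftComb K Q.τ s p 0 1 2 - rightComb K Q.τ s p 0 1 2 ∈ Q.rel)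
    (h4 : leftComb K Q.τ p s 0 1 2 - leftComb K Q.τ s s 0 1 2 ∈ Q.rel)
    (h5 : leftComb K Q.τ s s 0 1 2 - rightComb K Q.τ s s 0 1 2 ∈ Q.rel)
    (f : Gens K 1 →ₗ[K] Q.E) (hf : ∀ e, f (opp K 1 e) = Q.τ (f e))
    (hg : f (gen K 0) = p - Q.τ s) :
    mapTrees K f (leibRel K) ∈ Q.rel := by
  have hs := fun a ha => (Q.stable a ha).1
  have ht := fun a ha => (Q.stable a ha).2
  have hM := sub_mem (add_mem (add_mem (sub_mem (sub_mem h1 (hs _ (ht _ (add_mem h1 h2))))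
    (ht _ h3)) (hs _ h3)) (hs _ (hs _ (add_mem h4 h5)))) (hs _ (hs _ (ht _ h5)))
  simp only [leibRel, lm, rm, map_sub, mapTrees_leftComb _ Q.τ _ hf,
    mapTrees_rightComb _ Q.τ _ hf, hg]
  convert hM using 1
  ext u
  fin_cases u <;>
    simp [leftComb, rightComb, rot, swap, neg_one_fin3, neg_two_fin3, Q.τ_τ, TensorProduct.tmul_sub,
      TensorProduct.sub_tmul] <;> abel

theorem diAssToPerm_aux (Q : BinQuad K) (m : Q.E)
    (h1 : leftComb K Q.τ m m 0 1 2 - rightComb K Q.τ m m 0 1 2 ∈ Q.rel)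
    (h2 : rightComb K Q.τ m m 0 1 2 - rightComb K Q.τ m m 0 2 1 ∈ Q.rel)
    (f : Gens K 2 →ₗ[K] Q.E) (hf : ∀ e, f (opp K 2 e) = Q.τ (f e))
    (hp : f (gen K 0) = m) (hq : f (gen K 1) = Q.τ m) :
    ∀ a ∈ diAssRels K, mapTrees K f a ∈ Q.rel := by
  have hs := fun a ha => (Q.stable a ha).1
  have ht := fun a ha => (Q.stable a ha).2
  have h3 := sub_mem (ht _ (add_mem h1 h2)) (hs _ (hs _ h1))
  have h4 := hs _ h2
  have h5 := neg_mem (hs _ (hs _ (ht _ h1)))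
  rintro _ (rfl | rfl | rfl | rfl | rfl) <;>
    simp only [lm, rm, map_sub, mapTrees_leftComb _ Q.τ _ hf, mapTrees_rightComb _ Q.τ _ hf, hp, hq]
  · exact h1
  · convert h2 using 1
    ext u
    fin_cases u <;> simp [leftComb, rightComb]
  · convert h3 using 1
    ext u
    fin_cases u <;> simp [leftComb, rightComb, rot, swap, neg_one_fin3, neg_two_fin3, Q.τ_τ]
  · convert h4 using 1
    ext u
    fin_cases u <;> simp [leftComb, rightComb, rot]
  · convert h5 using 1
    ext u
    fin_cases u <;> simp [leftComb, rightComb, rot, swap, neg_one_fin3, neg_two_fin3, Q.τ_τ]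

variable (K)

/-- The morphism `Lie → Ass` given by `[x, y] = x y - y x`. -/
def lieToAss : LieOp K ⟶ Ass K :=
  have h : ∀ e, LinearMap.toSpanSingleton K (Gens K 1) (gen K 0 - opp K 1 (gen K 0))
      ((-LinearMap.id : K →ₗ[K] K) e)
      = opp K 1 (LinearMap.toSpanSingleton K (Gens K 1) (gen K 0 - opp K 1 (gen K 0)) e) := by
    intro e
    simp only [LinearMap.neg_apply, LinearMap.id_apply, LinearMap.toSpanSingleton_apply, map_smul,
      map_sub, opp_opp, neg_smul, smul_sub]
    abel
  BinQuad.homMk (LinearMap.toSpanSingleton K (Gens K 1) (gen K 0 - opp K 1 (gen K 0))) h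
    (by
      rintro _ rfl
      exact lieToAss_aux (Ass K) (gen K 0) (subset_relClosure K _ _ rfl) _ h (one_smul K _))

/-- The morphism `Ass → Com` which sends the product to the product. -/
def assToCom : Ass K ⟶ Com K :=
  BinQuad.homMk (gensLift (Com K).τ fun _ => (1 : K)) (gensLift_opp _ (Com K).τ_τ _)
    (by
      rintro _ rfl
      exact assToCom_aux (Com K) (1 : K) (subset_relClosure K _ _ rfl) _
        (gensLift_opp _ (Com K).τ_τ _) (gensLift_gen _ _ 0))

/-- The morphism `Leib → diAss` given by `x · y = x ≺ y - y ≻ x`. -/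
def leibToDiAss : Leib K ⟶ DiAss K :=
  BinQuad.homMk (gensLift (DiAss K).τ fun _ => diPrec K - (DiAss K).τ (diSucc K))
    (gensLift_opp _ (DiAss K).τ_τ _)
    (by
      rintro _ rfl
      have hr : ∀ a ∈ diAssRels K, a ∈ (DiAss K).rel := subset_relClosure K _ _
      exact leibToDiAss_aux (DiAss K) (diPrec K) (diSucc K) (hr _ (Or.inl rfl))
        (hr _ (Or.inr (Or.inl rfl))) (hr _ (Or.inr (Or.inr (Or.inl rfl))))
        (hr _ (Or.inr (Or.inr (Or.inr (Or.inl rfl)))))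
        (hr _ (Or.inr (Or.inr (Or.inr (Or.inr rfl))))) _ (gensLift_opp _ (DiAss K).τ_τ _)
        (gensLift_gen _ _ 0))

/-- The morphism `diAss → Perm` given by `x ≺ y = x ⋆ y` and `x ≻ y = y ⋆ x`. -/
def diAssToPerm : DiAss K ⟶ PermOp K :=
  BinQuad.homMk (gensLift (PermOp K).τ ![permDot K, (PermOp K).τ (permDot K)])
    (gensLift_opp _ (PermOp K).τ_τ _)
    (diAssToPerm_aux (PermOp K) (permDot K) (subset_relClosure K _ _ (Or.inl rfl))
      (subset_relClosure K _ _ (Or.inr rfl)) _ (gensLift_opp _ (PermOp K).τ_τ _)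
      (gensLift_gen _ _ 0) (gensLift_gen _ _ 1))

end Arrows

end BinaryOperad

end

open BinaryOperad

/-! The complexes in play live in degrees zero and one, so a product of total degree at least two
vanishes and no Koszul sign survives: a dg algebra is an ordinary algebra with graded products for
which the differential is a derivation on degree zero (`dgAlgOfAlg`).

On the whole interval, locality makes the product of 0-cochains pointwise. Two 0-cochains at
opposite vertices multiply to zero, and the Leibniz rule for this zero product identifies the edge
products in pairs: left vertex times edge equals edge times right vertex (this is `≺`), and right
vertex times edge equals edge times left vertex (this is `≻`, up to sign and order). At a single
vertex the Leibniz rule gives the product `x ≺ y - y ≻ x`. Hence `≺` and `≻` determine everything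
(`leibMul_eq`). The Leibniz relation on one edge and two opposite vertices is exactly the list of
diassociative axioms, and conversely these imply the relation on all cochains (`isDiAss`,
`isLeib_intervalMul`). The associated algebra is trivial precisely when `≻` is the opposite of `≺`,
and the axioms then become the permutative ones (`isDiAss_flip_iff`).

Relative to the left vertex, the differential is bijective from degree zero to degree one. The two
edge products are then free, the vertex product is `x ≺ y - y ≻ x` by the Leibniz rule, and the
relations come from placing the edge in each of the three positions (`isPreLieLeib`).

For the black products, equivariance of `Ψ` reduces the relators to the pairings of one generating
relator of `Lie`, `Ass` or `Com` with the six permutations of the Leibniz relator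
(`map_relClosure_black_le`). These are computed copy by copy in `𝓕(E)(3)`. For `Lie` the Jacobi
relator acts as a unit; for `Ass` and `Com` each image is, up to sign, a difference of two
monomials, and together they span the required axioms. The squares commute because they do so on
generators. -/

namespace BinaryOperad

/-! ### Evaluation of quadratic relators on elements -/

section Evaluation

variable {K : Type*} [Field K] {E A : Type*} [AddCommGroup E] [Module K E] [AddCommGroup A]
  [Module K A]

/-- The value of a vector of `𝓕(E)(3)` at three elements, for a family of products. -/
def evalTrees (m : E →ₗ[K] A →ₗ[K] A →ₗ[K] A) (x : Fin 3 → A) : Trees K E →ₗ[K] A :=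
  ∑ u, evalTree m x u ∘ₗ LinearMap.proj u

theorem evalTrees_apply (m : E →ₗ[K] A →ₗ[K] A →ₗ[K] A) (x : Fin 3 → A) (a : Trees K E) :
    evalTrees m x a = ∑ u, evalTree m x u (a u) := by
  simp [evalTrees]

@[simp]
theorem evalTree_tmul (m : E →ₗ[K] A →ₗ[K] A →ₗ[K] A) (x : Fin 3 → A) (i : Fin 3) (μ ν : E) :
    evalTree m x i (μ ⊗ₜ ν) = m μ (m ν (x i) (x (i + 1))) (x (i + 2)) := by
  simp [evalTree]

theorem evalTrees_single (m : E →ₗ[K] A →ₗ[K] A →ₗ[K] A) (x : Fin 3 → A) (i : Fin 3) (μ ν : E) :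
    evalTrees m x (Pi.single i (μ ⊗ₜ ν)) = m μ (m ν (x i) (x (i + 1))) (x (i + 2)) := by
  rw [evalTrees_apply, Finset.sum_eq_single i]
  · simp
  · intro j _ hj
    simp [hj]
  · simp

/-- Two distinct indices modulo 3 are cyclically consecutive in one of the two orders. In the second
order the monomial is stored with the opposite operation, which `hm` undoes. -/
theorem evalTrees_leftComb {τ : E →ₗ[K] E} {m : E →ₗ[K] A →ₗ[K] A →ₗ[K] A}
    (hm : ∀ e x y, m (τ e) x y = m e y x) (x : Fin 3 → A) (ν μ : E) (i j k : Fin 3)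
    (hij : i ≠ j) (hik : i ≠ k) (hjk : j ≠ k) :
    evalTrees m x (leftComb K τ ν μ i j k) = m μ (m ν (x i) (x j)) (x k) := by
  unfold leftComb
  split_ifs with h
  · have hk : i + 2 = k := by revert i j k; decide
    rw [evalTrees_single, ← h, hk]
  · have hi : j + 1 = i := by revert i j k; decide
    have hk : j + 2 = k := by revert i j k; decide
    rw [evalTrees_single, hi, hk, hm]

theorem evalTrees_rightComb {τ : E →ₗ[K] E} {m : E →ₗ[K] A →ₗ[K] A →ₗ[K] A}
    (hm : ∀ e x y, m (τ e) x y = m e y x) (x : Fin 3 → A) (μ ν : E) (i j k : Fin 3)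
    (hij : i ≠ j) (hik : i ≠ k) (hjk : j ≠ k) :
    evalTrees m x (rightComb K τ μ ν i j k) = m μ (x i) (m ν (x j) (x k)) := by
  rw [rightComb, evalTrees_leftComb hm x _ _ j k i hjk hij.symm hik.symm, hm]

theorem evalTree_congr (m : E →ₗ[K] A →ₗ[K] A →ₗ[K] A) (x y : Fin 3 → A) (i j : Fin 3)
    (h₀ : x i = y j) (h₁ : x (i + 1) = y (j + 1)) (h₂ : x (i + 2) = y (j + 2)) (t : E ⊗[K] E) :
    evalTree m x i t = evalTree m y j t := by
  induction t using TensorProduct.induction_on with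
  | zero => simp
  | add s t hs ht => simp only [map_add, hs, ht]
  | tmul μ ν => simp [h₀, h₁, h₂]

/-- Reindexing the copies by `u ↦ u + 1` moves the rotation to the arguments, where it becomes its
inverse, the shift by 2. -/
theorem evalTrees_rot (m : E →ₗ[K] A →ₗ[K] A →ₗ[K] A) (x : Fin 3 → A) (a : Trees K E) :
    evalTrees m x (rot K E a) = evalTrees m (fun i => x (i + 2)) a := by
  rw [evalTrees_apply, evalTrees_apply,
    ← Equiv.sum_comp (Equiv.addRight (1 : Fin 3)) fun u => evalTree m _ u (a u)]
  have h : ∀ u : Fin 3, u = u + 1 + 2 ∧ u + 1 = u + 1 + 1 + 2 ∧ u + 2 = u + 1 + 2 + 2 := by decide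
  exact Finset.sum_congr rfl fun u _ => evalTree_congr m x (fun i => x (i + 2)) u (u + 1)
    (congrArg x (h u).1) (congrArg x (h u).2.1) (congrArg x (h u).2.2) (a (u + 1))

/-- Modulo 3, the map `i ↦ 1 - i` exchanges 0 and 1 and fixes 2. It carries the pair `(u, u + 1)` to
`(-u + 1, -u)`, hence the copy `u` to the copy `-u` with its inner operation reversed. -/
theorem evalTrees_swap {τ : E →ₗ[K] E} {m : E →ₗ[K] A →ₗ[K] A →ₗ[K] A}
    (hm : ∀ e x y, m (τ e) x y = m e y x) (x : Fin 3 → A) (a : Trees K E) :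
    evalTrees m x (swap K τ a) = evalTrees m (fun i => x (1 - i)) a := by
  have h : ∀ u : Fin 3, -u = 1 - (u + 1) ∧ -u + 1 = 1 - u ∧ -u + 2 = 1 - (u + 2) := by decide
  rw [evalTrees_apply, evalTrees_apply, ← Equiv.sum_comp (Equiv.neg (Fin 3))]
  refine Finset.sum_congr rfl fun u _ => ?_
  simp only [swap, LinearMap.pi_apply, LinearMap.comp_apply, LinearMap.proj_apply, Equiv.neg_apply,
    neg_neg]
  induction a u using TensorProduct.induction_on with
  | zero => simp
  | add s t hs ht => simp only [map_add, hs, ht]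
  | tmul μ ν =>
    simp only [LinearMap.lTensor_tmul, evalTree_tmul, hm]
    rw [(h u).2.2, (h u).2.1, (h u).1]

/-- It suffices to check the relations of an algebra on generating relators. -/
theorem evalTrees_eq_zero_of_mem_relClosure {τ : E →ₗ[K] E} {m : E →ₗ[K] A →ₗ[K] A →ₗ[K] A}
    (hm : ∀ e x y, m (τ e) x y = m e y x) {s : Set (Trees K E)}
    (hs : ∀ a ∈ s, ∀ x, evalTrees m x a = 0) {a : Trees K E} (ha : a ∈ relClosure K τ s)
    (x : Fin 3 → A) : evalTrees m x a = 0 := by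
  -- The vectors that vanish at all triples form an invariant subspace, because permutations only
  -- permute the arguments.
  have key : relClosure K τ s ≤ ⨅ x, LinearMap.ker (evalTrees m x) := by
    refine relClosure_le K τ s _ (fun b hb => ?_) fun b hb => ?_
    · simp only [Submodule.mem_iInf, LinearMap.mem_ker] at hb ⊢
      exact ⟨fun x => by rw [evalTrees_rot, hb], fun x => by rw [evalTrees_swap hm, hb]⟩
    · simp only [SetLike.mem_coe, Submodule.mem_iInf, LinearMap.mem_ker]
      exact hs b hb
  simpa using (Submodule.mem_iInf _).1 (key ha) x

end Evaluation

/-! ### Algebras given by products without symmetry -/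

section Generators

variable {K : Type u} [Field K] {n : ℕ}

theorem gens_decomp (e : Gens K n) :
    e = ∑ i, ((e i).1 • gen K i + (e i).2 • opp K n (gen K i)) := by
  funext j
  rw [Finset.sum_apply, Finset.sum_eq_single j]
  · ext <;> simp [gen, opp]
  · intro i _ hi
    ext <;> simp [gen, opp, hi.symm]
  · simp

/-- Linear maps on operations without symmetry are determined by generators and opposites. -/
theorem gens_hom_ext {M : Type*} [AddCommGroup M] [Module K M] {f g : Gens K n →ₗ[K] M}
    (h : ∀ i, f (gen K i) = g (gen K i))
    (h' : ∀ i, f (opp K n (gen K i)) = g (opp K n (gen K i))) : f = g := by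
  refine LinearMap.ext fun e => ?_
  rw [gens_decomp e]
  simp only [map_sum, map_add, map_smul, h, h']

/-- Compatibility of a linear map with products can be checked on generators. -/
theorem gens_map_op {A B : Type*} [AddCommGroup A] [Module K A] [AddCommGroup B] [Module K B]
    {m : Gens K n →ₗ[K] A →ₗ[K] A →ₗ[K] A} {m' : Gens K n →ₗ[K] B →ₗ[K] B →ₗ[K] B}
    (hm : ∀ e x y, m (opp K n e) x y = m e y x) (hm' : ∀ e x y, m' (opp K n e) x y = m' e y x)
    (f : A →ₗ[K] B) (h : ∀ i x y, f (m (gen K i) x y) = m' (gen K i) (f x) (f y))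
    (e : Gens K n) (x y : A) : f (m e x y) = m' e (f x) (f y) := by
  rw [gens_decomp e]
  simp only [map_sum, map_add, map_smul, LinearMap.sum_apply, LinearMap.add_apply,
    LinearMap.smul_apply, hm, hm', h]

variable {V : Type v} [AddCommGroup V] [Module K V]

/-- The family of products which is spanned by given products and their opposites. -/
def opLift (c : Fin n → V →ₗ[K] V →ₗ[K] V) : Gens K n →ₗ[K] V →ₗ[K] V →ₗ[K] V :=
  ∑ i, (((LinearMap.fst K K K).smulRight (c i) + (LinearMap.snd K K K).smulRight (c i).flip)
    ∘ₗ LinearMap.proj i)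

theorem opLift_apply (c : Fin n → V →ₗ[K] V →ₗ[K] V) (e : Gens K n) (x y : V) :
    opLift c e x y = ∑ i, ((e i).1 • c i x y + (e i).2 • c i y x) := by
  simp [opLift, LinearMap.sum_apply]

theorem opLift_opp (c : Fin n → V →ₗ[K] V →ₗ[K] V) (e : Gens K n) (x y : V) :
    opLift c (opp K n e) x y = opLift c e y x := by
  simp [opLift_apply, opp, add_comm]

theorem opLift_gen (c : Fin n → V →ₗ[K] V →ₗ[K] V) (i : Fin n) : opLift c (gen K i) = c i := by
  ext x y
  rw [opLift_apply, Finset.sum_eq_single i] <;> simp +contextual [gen]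

/-- The algebra given by products which satisfy generating relators. -/
def algOfGens (s : Set (Trees K (Gens K n))) (c : Fin n → V →ₗ[K] V →ₗ[K] V)
    (h : ∀ a ∈ s, ∀ x, evalTrees (opLift c) x a = 0) : Alg (nonSymm K n s) V where
  op := opLift c
  op_swap := opLift_opp c
  op_rel a ha x :=
    (evalTrees_apply (opLift c) x a).symm.trans
      (evalTrees_eq_zero_of_mem_relClosure (opLift_opp c) h ha x)

variable {s : Set (Trees K (Gens K n))}

theorem alg_ext {S T : Alg (nonSymm K n s) V}
    (h : ∀ i x y, S.op (gen K i) x y = T.op (gen K i) x y) : S = T := by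
  refine Alg.ext (gens_hom_ext (f := S.op) (g := T.op) (fun i => ?_) fun i => ?_)
  · ext x y; exact h i x y
  · ext x y
    exact (S.op_swap _ x y).trans ((h i y x).trans (T.op_swap _ x y).symm)

theorem alg_op_mem (S : Alg (nonSymm K n s) V) {a : Trees K (Gens K n)} (ha : a ∈ s)
    (x : Fin 3 → V) : evalTrees (E := Gens K n) S.op x a = 0 :=
  (evalTrees_apply (E := Gens K n) S.op x a).trans (S.op_rel a (subset_relClosure K _ s ha) x)

end Generators

/-! ### Dg algebras on complexes in degrees zero and one -/

section TwoTerm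

variable {K : Type u} [Field K] {P : BinQuad K} {C₀ C₁ : Type v} [AddCommGroup C₀] [Module K C₀]
  [AddCommGroup C₁] [Module K C₁] {δ : C₀ →ₗ[K] C₁}

theorem mem_twoTermDeg_zero {z : C₀ × C₁} : z ∈ twoTermDeg (K := K) C₀ C₁ 0 ↔ z.2 = 0 := by
  refine ⟨?_, fun h => ⟨z.1, Prod.ext rfl h.symm⟩⟩
  rintro ⟨x, rfl⟩
  rfl

theorem mem_twoTermDeg_one {z : C₀ × C₁} : z ∈ twoTermDeg (K := K) C₀ C₁ 1 ↔ z.1 = 0 := by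
  refine ⟨?_, fun h => ⟨z.2, Prod.ext h.symm rfl⟩⟩
  rintro ⟨x, rfl⟩
  rfl

theorem eq_zero_of_mem_twoTermDeg {i : ℕ} (hi : 2 ≤ i) {z : C₀ × C₁}
    (hz : z ∈ twoTermDeg (K := K) C₀ C₁ i) : z = 0 := by
  match i, hi with
  | _ + 2, _ => exact hz

/-- At most one of the three arguments is odd, so no two odd elements are ever exchanged. -/
theorem koszulSign_eq_one {i : Fin 3 → ℕ} (hi : i 0 + i 1 + i 2 ≤ 1) (u : Fin 3) :
    koszulSign i u = 1 := by
  have h₁ : i 0 * (i 1 + i 2) = 0 := by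
    rcases Nat.eq_zero_or_pos (i 0) with h | h
    · simp [h]
    · rw [show i 1 + i 2 = 0 by lia, mul_zero]
  have h₂ : i 2 * (i 0 + i 1) = 0 := by
    rcases Nat.eq_zero_or_pos (i 2) with h | h
    · simp [h]
    · rw [show i 0 + i 1 = 0 by lia, mul_zero]
  fin_cases u <;> simp [koszulSign, h₁, h₂]

/-- The products of a dg algebra structure on a complex in degrees zero and one. -/
def DGAlg.pairOp (S : DGAlg P (twoTerm δ)) :
    P.E →ₗ[K] C₀ × C₁ →ₗ[K] C₀ × C₁ →ₗ[K] C₀ × C₁ :=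
  S.op

theorem DGAlg.pairOp_mem (S : DGAlg P (twoTerm δ)) (e : P.E) (i j : ℕ) {x y : C₀ × C₁}
    (hx : x ∈ twoTermDeg (K := K) C₀ C₁ i) (hy : y ∈ twoTermDeg (K := K) C₀ C₁ j) :
    S.pairOp e x y ∈ twoTermDeg (K := K) C₀ C₁ (i + j) :=
  S.op_mem e i j x hx y hy

theorem DGAlg.pairOp_zero_zero (S : DGAlg P (twoTerm δ)) (e : P.E) (x y : C₀) :
    (S.pairOp e (x, 0) (y, 0)).2 = 0 :=
  mem_twoTermDeg_zero.1 (S.pairOp_mem e 0 0 ⟨x, rfl⟩ ⟨y, rfl⟩)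

theorem DGAlg.pairOp_zero_one (S : DGAlg P (twoTerm δ)) (e : P.E) (x : C₀) (y : C₁) :
    (S.pairOp e (x, 0) (0, y)).1 = 0 :=
  mem_twoTermDeg_one.1 (S.pairOp_mem e 0 1 ⟨x, rfl⟩ ⟨y, rfl⟩)

theorem DGAlg.pairOp_one_zero (S : DGAlg P (twoTerm δ)) (e : P.E) (x : C₁) (y : C₀) :
    (S.pairOp e (0, x) (y, 0)).1 = 0 :=
  mem_twoTermDeg_one.1 (S.pairOp_mem e 1 0 ⟨x, rfl⟩ ⟨y, rfl⟩)

theorem DGAlg.pairOp_one_one (S : DGAlg P (twoTerm δ)) (e : P.E) (x y : C₁) :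
    S.pairOp e (0, x) (0, y) = 0 :=
  eq_zero_of_mem_twoTermDeg le_rfl (S.pairOp_mem e 1 1 ⟨x, rfl⟩ ⟨y, rfl⟩)

theorem DGAlg.pairOp_leibniz (S : DGAlg P (twoTerm δ)) (e : P.E) (x y : C₀) :
    δ (S.pairOp e (x, 0) (y, 0)).1
      = (S.pairOp e (0, δ x) (y, 0)).2 + (S.pairOp e (x, 0) (0, δ y)).2 := by
  have h := congrArg Prod.snd (S.leibniz e 0 ((x, 0) : C₀ × C₁) ⟨x, rfl⟩ ((y, 0) : C₀ × C₁))
  rw [pow_zero, one_smul] at h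
  exact h

/-- On a complex in degrees zero and one, the Koszul sign of the transposition plays no role. -/
theorem DGAlg.pairOp_swap (S : DGAlg P (twoTerm δ)) (e : P.E) (x y : C₀ × C₁) :
    S.pairOp (P.τ e) x y = S.pairOp e y x := by
  -- The sign is trivial as soon as one degree is zero. The remaining case, two elements of degree
  -- one, has zero product on both sides.
  have key : ∀ i j, i * j = 0 → ∀ x ∈ twoTermDeg (K := K) C₀ C₁ i,
      ∀ y ∈ twoTermDeg (K := K) C₀ C₁ j, S.pairOp (P.τ e) x y = S.pairOp e y x := by
    intro i j hij x hx y hy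
    have h := S.op_swap e i j x hx y hy
    rw [hij, pow_zero, one_smul] at h
    exact h
  obtain ⟨x₀, x₁⟩ := x
  obtain ⟨y₀, y₁⟩ := y
  have hx : ((x₀, x₁) : C₀ × C₁) = (x₀, 0) + (0, x₁) := by simp
  have hy : ((y₀, y₁) : C₀ × C₁) = (y₀, 0) + (0, y₁) := by simp
  rw [hx, hy]
  simp only [map_add, LinearMap.add_apply, S.pairOp_one_one]
  rw [key 0 0 rfl (x₀, 0) ⟨x₀, rfl⟩ (y₀, 0) ⟨y₀, rfl⟩,
    key 0 1 rfl (x₀, 0) ⟨x₀, rfl⟩ (0, y₁) ⟨y₁, rfl⟩,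
    key 1 0 rfl (0, x₁) ⟨x₁, rfl⟩ (y₀, 0) ⟨y₀, rfl⟩]
  abel

theorem DGAlg.pairOp_rel (S : DGAlg P (twoTerm δ)) {a : Trees K P.E} (ha : a ∈ P.rel)
    (i : Fin 3 → ℕ) (hi : i 0 + i 1 + i 2 ≤ 1) (x : Fin 3 → C₀ × C₁)
    (hx : ∀ k, x k ∈ twoTermDeg (K := K) C₀ C₁ (i k)) : evalTrees S.pairOp x a = 0 := by
  rw [evalTrees_apply]
  have h := S.op_rel a ha i x hx
  simp only [koszulSign_eq_one hi, one_smul] at h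
  exact h

/-- Every tree uses each argument exactly once, so all three copies have the same total degree. -/
theorem evalTree_mem_twoTermDeg {E : Type*} [AddCommGroup E] [Module K E]
    {m : E →ₗ[K] C₀ × C₁ →ₗ[K] C₀ × C₁ →ₗ[K] C₀ × C₁}
    (hm : ∀ e i j, ∀ x ∈ twoTermDeg (K := K) C₀ C₁ i, ∀ y ∈ twoTermDeg (K := K) C₀ C₁ j,
      m e x y ∈ twoTermDeg (K := K) C₀ C₁ (i + j))
    {i : Fin 3 → ℕ} {x : Fin 3 → C₀ × C₁} (hx : ∀ k, x k ∈ twoTermDeg (K := K) C₀ C₁ (i k))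
    (u : Fin 3) (t : E ⊗[K] E) :
    evalTree m x u t ∈ twoTermDeg (K := K) C₀ C₁ (i 0 + i 1 + i 2) := by
  have hi : i u + i (u + 1) + i (u + 2) = i 0 + i 1 + i 2 := by
    fin_cases u
    · rfl
    · change i 1 + i 2 + i 0 = _; lia
    · change i 2 + i 0 + i 1 = _; lia
  rw [← hi]
  induction t using TensorProduct.induction_on with
  | zero => rw [map_zero]; exact zero_mem _
  | add s t hs ht => rw [map_add]; exact add_mem hs ht
  | tmul μ ν => rw [evalTree_tmul]; exact hm _ _ _ _ (hm _ _ _ _ (hx _) _ (hx _)) _ (hx _)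

/-- On a complex in degrees zero and one, a dg algebra structure is an algebra structure with
products of degree zero which satisfy the Leibniz rule in degree zero. -/
def dgAlgOfAlg (S : Alg P (C₀ × C₁)) (h₀₀ : ∀ e x y, (S.op e (x, 0) (y, 0)).2 = 0)
    (h₀₁ : ∀ e x y, (S.op e (x, 0) (0, y)).1 = 0) (h₁₁ : ∀ e x y, S.op e (0, x) (0, y) = 0)
    (hδ : ∀ e x y, δ (S.op e (x, 0) (y, 0)).1
      = (S.op e (0, δ x) (y, 0)).2 + (S.op e (x, 0) (0, δ y)).2) : DGAlg P (twoTerm δ) :=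
  -- Every operation is the opposite of another one, so this case is the case of degrees zero and
  -- one with the arguments exchanged.
  have h₁₀ : ∀ e x y, (S.op e (0, x) (y, 0)).1 = 0 := by
    intro e x y
    rw [← P.τ_τ e, S.op_swap]
    exact h₀₁ _ y x
  have hmem : ∀ e i j, ∀ x ∈ twoTermDeg (K := K) C₀ C₁ i, ∀ y ∈ twoTermDeg (K := K) C₀ C₁ j,
      S.op e x y ∈ twoTermDeg (K := K) C₀ C₁ (i + j) := by
    intro e i j x hx y hy
    match i, j, hx, hy with
    | 0, 0, ⟨x, hx⟩, ⟨y, hy⟩ => subst hx hy; exact mem_twoTermDeg_zero.2 (h₀₀ e x y)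
    | 0, 1, ⟨x, hx⟩, ⟨y, hy⟩ => subst hx hy; exact mem_twoTermDeg_one.2 (h₀₁ e x y)
    | 1, 0, ⟨x, hx⟩, ⟨y, hy⟩ => subst hx hy; exact mem_twoTermDeg_one.2 (h₁₀ e x y)
    | 1, 1, ⟨x, hx⟩, ⟨y, hy⟩ => subst hx hy; exact h₁₁ e x y
    | i + 2, j, hx, hy =>
      rw [(Submodule.mem_bot K).1 hx, map_zero, LinearMap.zero_apply]; exact zero_mem _
    | i, j + 2, hx, hy => rw [(Submodule.mem_bot K).1 hy, map_zero]; exact zero_mem _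
  have hswap : ∀ e i j, ∀ x ∈ twoTermDeg (K := K) C₀ C₁ i, ∀ y ∈ twoTermDeg (K := K) C₀ C₁ j,
      S.op (P.τ e) x y = (-1 : ℤ) ^ (i * j) • S.op e y x := by
    intro e i j x hx y hy
    rcases Nat.eq_zero_or_pos (i * j) with h | h
    · rw [h, pow_zero, one_smul]
      exact S.op_swap e x y
    · have h₂ : 2 ≤ i + j := by
        have := Nat.pos_of_mul_pos_right h
        have := Nat.pos_of_mul_pos_left h
        lia
      rw [eq_zero_of_mem_twoTermDeg h₂ (hmem (P.τ e) i j x hx y hy),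
        eq_zero_of_mem_twoTermDeg (by lia) (hmem e j i y hy x hx), smul_zero]
  -- Only a pair of arguments of degree zero gives a condition, namely `hδ`; otherwise every term
  -- has degree at least two and vanishes.
  have hleib : ∀ e i, ∀ x ∈ twoTermDeg (K := K) C₀ C₁ i, ∀ y : C₀ × C₁,
      ((0, δ (S.op e x y).1) : C₀ × C₁)
        = S.op e (0, δ x.1) y + (-1 : ℤ) ^ i • S.op e x (0, δ y.1) := by
    rintro e i x hx ⟨y₀, y₁⟩
    have hy : ((y₀, y₁) : C₀ × C₁) = (y₀, 0) + (0, y₁) := by simp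
    match i, hx with
    | 0, ⟨x, hx⟩ =>
      subst hx
      rw [hy]
      ext <;> simp only [LinearMap.inl_apply, map_add, Prod.fst_add, Prod.snd_add, h₀₁, h₁₀, h₁₁, hδ,
        pow_zero, one_smul, add_zero]
    | 1, ⟨x, hx⟩ =>
      subst hx
      rw [hy]
      ext <;> simp only [LinearMap.inr_apply, map_add, Prod.fst_add, h₁₀, h₁₁,
        Prod.fst_zero, Prod.snd_zero, map_zero, add_zero, smul_zero, Prod.mk_zero_zero,
        LinearMap.zero_apply]
    | i + 2, hx =>
      rw [(Submodule.mem_bot K).1 hx]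
      simp only [map_zero, LinearMap.zero_apply, Prod.fst_zero, Prod.mk_zero_zero, smul_zero,
        add_zero]
  have hrel : ∀ a ∈ P.rel, ∀ (i : Fin 3 → ℕ) (x : Fin 3 → C₀ × C₁),
      (∀ k, x k ∈ twoTermDeg (K := K) C₀ C₁ (i k)) →
        ∑ u, koszulSign i u • evalTree S.op x u (a u) = 0 := by
    intro a ha i x hx
    -- In total degree at least two each tree vanishes separately; in total degree at most one all
    -- signs are 1.
    rcases Nat.lt_or_ge 1 (i 0 + i 1 + i 2) with h | h
    · refine Finset.sum_eq_zero fun u _ => ?_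
      rw [eq_zero_of_mem_twoTermDeg h (evalTree_mem_twoTermDeg hmem hx u (a u)), smul_zero]
    · simp only [koszulSign_eq_one h, one_smul]
      exact S.op_rel a ha x
  ⟨S.op, hmem, hswap, hleib, hrel⟩

end TwoTerm

/-! ### The relations as identities between elements -/

section Relations

variable {K : Type u} [Field K] {A : Type*} [AddCommGroup A] [Module K A]

theorem evalTrees_lm {n : ℕ} {m : Gens K n →ₗ[K] A →ₗ[K] A →ₗ[K] A}
    (hm : ∀ e x y, m (opp K n e) x y = m e y x) (x : Fin 3 → A) (a b : Gens K n) (i j k : Fin 3)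
    (h : i ≠ j ∧ i ≠ k ∧ j ≠ k) :
    evalTrees m x (lm a b i j k) = m b (m a (x i) (x j)) (x k) :=
  evalTrees_leftComb hm x a b i j k h.1 h.2.1 h.2.2

theorem evalTrees_rm {n : ℕ} {m : Gens K n →ₗ[K] A →ₗ[K] A →ₗ[K] A}
    (hm : ∀ e x y, m (opp K n e) x y = m e y x) (x : Fin 3 → A) (a b : Gens K n) (i j k : Fin 3)
    (h : i ≠ j ∧ i ≠ k ∧ j ≠ k) :
    evalTrees m x (rm a b i j k) = m a (x i) (m b (x j) (x k)) :=
  evalTrees_rightComb hm x a b i j k h.1 h.2.1 h.2.2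

/-- The relation of right Leibniz algebras. -/
def IsLeib (m : A →ₗ[K] A →ₗ[K] A) : Prop :=
  ∀ x y z, m (m x y) z = m x (m y z) + m (m x z) y

/-- The relations of right permutative algebras. -/
def IsPerm (m : A →ₗ[K] A →ₗ[K] A) : Prop :=
  ∀ x y z, m (m x y) z = m x (m y z) ∧ m x (m y z) = m x (m z y)

/-- The relations of diassociative algebras. -/
def IsDiAss (p s : A →ₗ[K] A →ₗ[K] A) : Prop :=
  ∀ x y z, p (p x y) z = p x (p y z) ∧ p x (p y z) = p x (s y z) ∧ p (s x y) z = s x (p y z) ∧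
    s (p x y) z = s (s x y) z ∧ s (s x y) z = s x (s y z)

/-- The relations of the operad `PreLieLeib`. -/
def IsPreLieLeib (p s : A →ₗ[K] A →ₗ[K] A) : Prop :=
  ∀ x y z, p x (p y z) - p x (s z y) = p (p x y) z - p (p x z) y ∧
    s (s x y) z = s (p x y) z ∧
    s x (p y z) - s x (s z y) = p (s x y) z - s (p x z) y

theorem evalTrees_leibRel {m : Gens K 1 →ₗ[K] A →ₗ[K] A →ₗ[K] A}
    (hm : ∀ e x y, m (opp K 1 e) x y = m e y x) (x : Fin 3 → A) :
    evalTrees m x (leibRel K) = m (gen K 0) (m (gen K 0) (x 0) (x 1)) (x 2)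
      - m (gen K 0) (x 0) (m (gen K 0) (x 1) (x 2))
      - m (gen K 0) (m (gen K 0) (x 0) (x 2)) (x 1) := by
  rw [leibRel, map_sub, map_sub, evalTrees_lm hm _ _ _ _ _ _ (by decide),
    evalTrees_rm hm _ _ _ _ _ _ (by decide), evalTrees_lm hm _ _ _ _ _ _ (by decide)]

theorem leibRel_iff {m : Gens K 1 →ₗ[K] A →ₗ[K] A →ₗ[K] A}
    (hm : ∀ e x y, m (opp K 1 e) x y = m e y x) :
    (∀ a ∈ ({leibRel K} : Set (Trees K (Gens K 1))), ∀ x, evalTrees m x a = 0)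
      ↔ IsLeib (m (gen K 0)) := by
  simp only [Set.mem_singleton_iff, forall_eq, evalTrees_leibRel hm, sub_sub, sub_eq_zero]
  exact ⟨fun h x y z => h ![x, y, z], fun h x => h _ _ _⟩

theorem permRels_iff {m : Gens K 1 →ₗ[K] A →ₗ[K] A →ₗ[K] A}
    (hm : ∀ e x y, m (opp K 1 e) x y = m e y x) :
    (∀ a ∈ ({assRel K, rm (gen K 0) (gen K 0) 0 1 2 - rm (gen K 0) (gen K 0) 0 2 1} :
        Set (Trees K (Gens K 1))), ∀ x, evalTrees m x a = 0)
      ↔ IsPerm (m (gen K 0)) := by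
  simp only [Set.mem_insert_iff, Set.mem_singleton_iff, forall_eq_or_imp, forall_eq, assRel, map_sub,
    evalTrees_lm hm _ _ _ 0 1 2 (by decide), evalTrees_rm hm _ _ _ 0 1 2 (by decide),
    evalTrees_rm hm _ _ _ 0 2 1 (by decide), sub_eq_zero, ← forall_and]
  exact ⟨fun h x y z => h ![x, y, z], fun h x => h _ _ _⟩

theorem diAssRels_iff {m : Gens K 2 →ₗ[K] A →ₗ[K] A →ₗ[K] A}
    (hm : ∀ e x y, m (opp K 2 e) x y = m e y x) :
    (∀ a ∈ diAssRels K, ∀ x, evalTrees m x a = 0) ↔ IsDiAss (m (gen K 0)) (m (gen K 1)) := by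
  simp only [diAssRels, Set.mem_insert_iff, Set.mem_singleton_iff, forall_eq_or_imp, forall_eq,
    map_sub, evalTrees_lm hm _ _ _ 0 1 2 (by decide), evalTrees_rm hm _ _ _ 0 1 2 (by decide),
    sub_eq_zero, ← forall_and]
  exact ⟨fun h x y z => h ![x, y, z], fun h x => h _ _ _⟩

theorem preLieLeibRels'_iff {m : Gens K 2 →ₗ[K] A →ₗ[K] A →ₗ[K] A}
    (hm : ∀ e x y, m (opp K 2 e) x y = m e y x) :
    (∀ a ∈ preLieLeibRels' K, ∀ x, evalTrees m x a = 0)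
      ↔ IsPreLieLeib (m (gen K 0)) (m (gen K 1)) := by
  simp only [preLieLeibRels', Set.mem_insert_iff, Set.mem_singleton_iff, forall_eq_or_imp,
    forall_eq, map_sub, evalTrees_lm hm _ _ _ 0 1 2 (by decide),
    evalTrees_lm hm _ _ _ 0 2 1 (by decide), evalTrees_rm hm _ _ _ 0 1 2 (by decide),
    evalTrees_rm hm _ _ _ 0 2 1 (by decide), sub_eq_zero, ← forall_and]
  exact ⟨fun h x y z => h ![x, y, z], fun h x => h _ _ _⟩

end Relations

/-! ### Algebras over the operads of the theorem -/

section Algebras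

variable {K : Type u} [Field K] {V : Type v} [AddCommGroup V] [Module K V]

/-- The operations of an algebra over an operad whose generators have no symmetry. -/
def Alg.gensOp {n : ℕ} {s : Set (Trees K (Gens K n))} (S : Alg (nonSymm K n s) V) :
    Gens K n →ₗ[K] V →ₗ[K] V →ₗ[K] V :=
  S.op

theorem Alg.gensOp_opp {n : ℕ} {s : Set (Trees K (Gens K n))} (S : Alg (nonSymm K n s) V)
    (e : Gens K n) (x y : V) : S.gensOp (opp K n e) x y = S.gensOp e y x :=
  S.op_swap e x y

theorem Alg.evalTrees_gensOp {n : ℕ} {s : Set (Trees K (Gens K n))} (S : Alg (nonSymm K n s) V) :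
    ∀ a ∈ s, ∀ x, evalTrees S.gensOp x a = 0 :=
  fun _ ha x => alg_op_mem S ha x

theorem algType_isHom_iff {n : ℕ} {s : Set (Trees K (Gens K n))} {W : Type v} [AddCommGroup W]
    [Module K W] (S : Alg (nonSymm K n s) V) (T : Alg (nonSymm K n s) W) (f : V →ₗ[K] W) :
    (algType.{u, v} (nonSymm K n s)).IsHom S T f ↔
      ∀ i x y, f (S.gensOp (gen K i) x y) = T.gensOp (gen K i) (f x) (f y) :=
  ⟨fun h _ => h _, fun h => gens_map_op S.gensOp_opp T.gensOp_opp f h⟩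

theorem algOfGens_isHom_iff {n : ℕ} {s : Set (Trees K (Gens K n))} {W : Type v} [AddCommGroup W]
    [Module K W] {c : Fin n → V →ₗ[K] V →ₗ[K] V} {c' : Fin n → W →ₗ[K] W →ₗ[K] W}
    (h : ∀ a ∈ s, ∀ x, evalTrees (opLift c) x a = 0)
    (h' : ∀ a ∈ s, ∀ x, evalTrees (opLift c') x a = 0) (f : V →ₗ[K] W) :
    (algType.{u, v} (nonSymm K n s)).IsHom (algOfGens s c h) (algOfGens s c' h') f ↔
      ∀ i x y, f (c i x y) = c' i (f x) (f y) := by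
  refine (algType_isHom_iff (algOfGens s c h) (algOfGens s c' h') f).trans ?_
  have hc : ∀ i, (algOfGens s c h).gensOp (gen K i) = c i := opLift_gen c
  have hc' : ∀ i, (algOfGens s c' h').gensOp (gen K i) = c' i := opLift_gen c'
  simp only [hc, hc']

/-- The Leibniz algebra with a given product. -/
def leibAlg (m : V →ₗ[K] V →ₗ[K] V) (hm : IsLeib m) : Alg (Leib K) V :=
  algOfGens _ ![m] <| (leibRel_iff (opLift_opp _)).2 <| by rw [opLift_gen]; exact hm

/-- The permutative algebra with a given product. -/
def permAlg (m : V →ₗ[K] V →ₗ[K] V) (hm : IsPerm m) : Alg (PermOp K) V :=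
  algOfGens _ ![m] <| (permRels_iff (opLift_opp _)).2 <| by rw [opLift_gen]; exact hm

/-- The diassociative algebra with given products. -/
def diAssAlg (p s : V →ₗ[K] V →ₗ[K] V) (h : IsDiAss p s) : Alg (DiAss K) V :=
  algOfGens _ ![p, s] <| (diAssRels_iff (opLift_opp _)).2 <| by
    rw [opLift_gen, opLift_gen]; exact h

/-- The algebra over `PreLieLeib` with given products. -/
def preLieLeibAlg (p s : V →ₗ[K] V →ₗ[K] V) (h : IsPreLieLeib p s) : Alg (PreLieLeib K) V :=
  algOfGens _ ![p, s] <| (preLieLeibRels'_iff (opLift_opp _)).2 <| by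
    rw [opLift_gen, opLift_gen]; exact h

theorem permAlg_isHom_iff {W : Type v} [AddCommGroup W] [Module K W] {m : V →ₗ[K] V →ₗ[K] V}
    {m' : W →ₗ[K] W →ₗ[K] W} (h : IsPerm m) (h' : IsPerm m') (f : V →ₗ[K] W) :
    (algType.{u, v} (PermOp K)).IsHom (permAlg m h) (permAlg m' h') f ↔
      ∀ x y, f (m x y) = m' (f x) (f y) :=
  (algOfGens_isHom_iff (c := ![m]) (c' := ![m']) _ _ f).trans Fin.forall_fin_one

theorem diAssAlg_isHom_iff {W : Type v} [AddCommGroup W] [Module K W] {p s : V →ₗ[K] V →ₗ[K] V}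
    {p' s' : W →ₗ[K] W →ₗ[K] W} (h : IsDiAss p s) (h' : IsDiAss p' s') (f : V →ₗ[K] W) :
    (algType.{u, v} (DiAss K)).IsHom (diAssAlg p s h) (diAssAlg p' s' h') f ↔
      (∀ x y, f (p x y) = p' (f x) (f y)) ∧ ∀ x y, f (s x y) = s' (f x) (f y) :=
  (algOfGens_isHom_iff (c := ![p, s]) (c' := ![p', s']) _ _ f).trans Fin.forall_fin_two

theorem preLieLeibAlg_isHom_iff {W : Type v} [AddCommGroup W] [Module K W]
    {p s : V →ₗ[K] V →ₗ[K] V} {p' s' : W →ₗ[K] W →ₗ[K] W} (h : IsPreLieLeib p s)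
    (h' : IsPreLieLeib p' s') (f : V →ₗ[K] W) :
    (algType.{u, v} (PreLieLeib K)).IsHom (preLieLeibAlg p s h) (preLieLeibAlg p' s' h') f ↔
      (∀ x y, f (p x y) = p' (f x) (f y)) ∧ ∀ x y, f (s x y) = s' (f x) (f y) :=
  (algOfGens_isHom_iff (c := ![p, s]) (c' := ![p', s']) _ _ f).trans Fin.forall_fin_two

end Algebras

/-! ### Dg Leibniz algebras in degrees zero and one -/

section LeibnizTwoTerm

variable {K : Type u} [Field K] {C₀ C₁ : Type v} [AddCommGroup C₀] [Module K C₀]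
  [AddCommGroup C₁] [Module K C₁] {δ : C₀ →ₗ[K] C₁}

/-- The product of a dg Leibniz algebra in degrees zero and one. -/
def DGAlg.leibMul (S : DGAlg (Leib K) (twoTerm δ)) : C₀ × C₁ →ₗ[K] C₀ × C₁ →ₗ[K] C₀ × C₁ :=
  S.pairOp (leibDot K)

theorem DGAlg.leibMul_rel (S : DGAlg (Leib K) (twoTerm δ)) (i j k : ℕ) (h : i + j + k ≤ 1)
    {x y z : C₀ × C₁} (hx : x ∈ twoTermDeg (K := K) C₀ C₁ i)
    (hy : y ∈ twoTermDeg (K := K) C₀ C₁ j) (hz : z ∈ twoTermDeg (K := K) C₀ C₁ k) :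
    S.leibMul (S.leibMul x y) z = S.leibMul x (S.leibMul y z) + S.leibMul (S.leibMul x z) y := by
  have hr := S.pairOp_rel (subset_relClosure K _ _ rfl : leibRel K ∈ (Leib K).rel) ![i, j, k] h
    ![x, y, z] (by intro l; fin_cases l; exacts [hx, hy, hz])
  have hr' := (evalTrees_leibRel (m := S.pairOp) S.pairOp_swap ![x, y, z]).symm.trans hr
  rw [sub_sub, sub_eq_zero] at hr'
  exact hr'

theorem DGAlg.pairOp_eq_leibMul (S : DGAlg (Leib K) (twoTerm δ)) (e : Gens K 1) (x y : C₀ × C₁) :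
    S.pairOp e x y = (e 0).1 • S.leibMul x y + (e 0).2 • S.leibMul y x := by
  have h := LinearMap.congr_fun₂ (congrArg S.pairOp (gens_decomp e)) x y
  rw [Fin.sum_univ_one] at h
  have h' : S.pairOp (opp K 1 (gen K 0)) x y = S.pairOp (gen K 0 : Gens K 1) y x := S.pairOp_swap _ x y
  refine h.trans ((LinearMap.congr_fun₂ (map_add S.pairOp _ _) x y).trans ?_)
  exact congrArg₂ (· + ·) (LinearMap.congr_fun₂ (map_smul S.pairOp _ _) x y)
    ((LinearMap.congr_fun₂ (map_smul S.pairOp _ _) x y).trans (congrArg ((e 0).2 • ·) h'))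

theorem DGAlg.leib_ext {S T : DGAlg (Leib K) (twoTerm δ)} (h : S.leibMul = T.leibMul) : S = T :=
  DGAlg.ext <| LinearMap.ext fun e => LinearMap.ext₂ fun x y =>
    (S.pairOp_eq_leibMul e x y).trans <| (T.pairOp_eq_leibMul e x y).symm ▸ by rw [h]

theorem DGAlg.leib_map_op {D₀ D₁ : Type v} [AddCommGroup D₀] [Module K D₀] [AddCommGroup D₁]
    [Module K D₁] {δ' : D₀ →ₗ[K] D₁} {S : DGAlg (Leib K) (twoTerm δ)}
    {T : DGAlg (Leib K) (twoTerm δ')} (f : C₀ × C₁ →ₗ[K] D₀ × D₁)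
    (h : ∀ x y, f (S.leibMul x y) = T.leibMul (f x) (f y)) (e : (Leib K).E) (x y : C₀ × C₁) :
    f (S.pairOp e x y) = T.pairOp e (f x) (f y) := by
  refine (congrArg f (S.pairOp_eq_leibMul e x y)).trans
    (Eq.trans ?_ (T.pairOp_eq_leibMul e (f x) (f y)).symm)
  rw [map_add, map_smul, map_smul, h, h]

/-- A Leibniz product of degree zero on a complex in degrees zero and one, for which the
differential is a derivation, is a dg Leibniz algebra structure. -/
def dgLeib (m : C₀ × C₁ →ₗ[K] C₀ × C₁ →ₗ[K] C₀ × C₁) (hm : IsLeib m)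
    (h₀₀ : ∀ x y, (m (x, 0) (y, 0)).2 = 0) (h₀₁ : ∀ x y, (m (x, 0) (0, y)).1 = 0)
    (h₁₀ : ∀ x y, (m (0, x) (y, 0)).1 = 0) (h₁₁ : ∀ x y, m (0, x) (0, y) = 0)
    (hδ : ∀ x y, δ (m (x, 0) (y, 0)).1 = (m (0, δ x) (y, 0)).2 + (m (x, 0) (0, δ y)).2) :
    DGAlg (Leib K) (twoTerm δ) :=
  have hop : ∀ (e : Gens K 1) (x y : C₀ × C₁),
      opLift ![m] e x y = (e 0).1 • m x y + (e 0).2 • m y x := by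
    intro e x y
    simp [opLift_apply]
  -- The rule is linear in the operation and, on degree zero, is preserved when the product is
  -- replaced with its opposite.
  have hop_δ : ∀ (e : Gens K 1) (x y : C₀), δ (opLift ![m] e (x, 0) (y, 0)).1
      = (opLift ![m] e (0, δ x) (y, 0)).2 + (opLift ![m] e (x, 0) (0, δ y)).2 := by
    intro e x y
    simp only [hop, Prod.fst_add, Prod.smul_fst, Prod.snd_add, Prod.smul_snd, map_add, map_smul,
      hδ, smul_add]
    abel
  dgAlgOfAlg (leibAlg m hm)
    (fun e x y => (congrArg Prod.snd (hop e _ _)).trans (by simp [h₀₀]))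
    (fun e x y => (congrArg Prod.fst (hop e _ _)).trans (by simp [h₀₁, h₁₀]))
    (fun e x y => (hop e _ _).trans (by simp [h₁₁])) hop_δ

end LeibnizTwoTerm

/-! ### Local dg Leibniz structures on the interval and diassociative algebras -/

section Interval

variable {K : Type u} [Field K] {V : Type v} [AddCommGroup V] [Module K V]

/-- The product of cochains on the interval which is determined by two products `≺`, `≻` on the
coefficients. -/
def intervalMul (p s : V →ₗ[K] V →ₗ[K] V) :
    (Fin 2 → V) × V →ₗ[K] (Fin 2 → V) × V →ₗ[K] (Fin 2 → V) × V :=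
  LinearMap.mk₂ K
    -- A 0-cochain acts on the edge from the left through `≺` at the left vertex and `≻` at the
    -- right vertex. From the right, the two vertices exchange their roles.
    (fun x y => (fun i => p (x.1 i) (y.1 i) - s (y.1 i) (x.1 i),
      p (x.1 0) y.2 - s y.2 (x.1 1) + p x.2 (y.1 1) - s (y.1 0) x.2))
    (fun x x' y => by
      refine Prod.ext (funext fun i => ?_) ?_ <;> simp <;> abel)
    (fun c x y => by
      refine Prod.ext (funext fun i => ?_) ?_ <;> simp [smul_sub, smul_add])
    (fun x x' y => by
      refine Prod.ext (funext fun i => ?_) ?_ <;> simp <;> abel)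
    (fun c x y => by
      refine Prod.ext (funext fun i => ?_) ?_ <;> simp [smul_sub, smul_add])

theorem intervalMul_apply (p s : V →ₗ[K] V →ₗ[K] V) (x y : (Fin 2 → V) × V) :
    intervalMul p s x y = (fun i => p (x.1 i) (y.1 i) - s (y.1 i) (x.1 i),
      p (x.1 0) y.2 - s y.2 (x.1 1) + p x.2 (y.1 1) - s (y.1 0) x.2) :=
  rfl

theorem isLeib_intervalMul {p s : V →ₗ[K] V →ₗ[K] V} (h : IsDiAss p s) :
    IsLeib (intervalMul p s) := by
  have h₁ := fun x y z => (h x y z).1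
  -- This axiom is reversed so that the five rewriting rules end in the three normal forms `x ≺ (y ≺
  -- z)`, `x ≻ (y ≺ z)` and `x ≻ (y ≻ z)`, one for each possible class of monomials in a given order
  -- of the letters.
  have h₂ := fun x y z => (h x y z).2.1.symm
  have h₃ := fun x y z => (h x y z).2.2.1
  have h₄ := fun x y z => (h x y z).2.2.2.1
  have h₅ := fun x y z => (h x y z).2.2.2.2
  intro x y z
  refine Prod.ext (funext fun i => ?_) ?_ <;>
    simp only [intervalMul_apply, Prod.fst_add, Prod.snd_add, Pi.add_apply, map_sub, map_add,
      LinearMap.sub_apply, LinearMap.add_apply, h₁, h₂, h₃, h₄, h₅] <;> abel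

/-- The local dg Leibniz algebra structure on cochains given by a diassociative algebra. -/
def assBulletLeib (p s : V →ₗ[K] V →ₗ[K] V) (h : IsDiAss p s) : AssBulletStr (Leib K) V where
  toDGAlg := dgLeib (intervalMul p s) (isLeib_intervalMul h)
    (fun x y => by simp [intervalMul_apply])
    (fun x y => by ext; simp [intervalMul_apply])
    (fun x y => by ext; simp [intervalMul_apply])
    (fun x y => by ext <;> simp [intervalMul_apply])
    (fun x y => by simp [intervalMul_apply, coboundary]; abel)
  isLocal X := by
    -- Locality: the value of a product at a vertex involves only the values of the factors at that
    -- vertex.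
    have hm : ∀ x y : (Fin 2 → V) × V, ∀ i, (x.1 i = 0 ∨ y.1 i = 0) →
        (intervalMul p s x y).1 i = 0 := by
      rintro x y i (hi | hi) <;> simp [intervalMul_apply, hi]
    refine ⟨fun x hx => ⟨fun i hi => rfl, trivial⟩, fun e x hx y => ?_⟩
    have hop : ∀ (e : Gens K 1) (x y : (Fin 2 → V) × V) (i), (x.1 i = 0 ∨ y.1 i = 0) →
        (opLift ![intervalMul p s] e x y).1 i = 0 := by
      intro e x y i hi
      simp [opLift_apply, hm x y i hi, hm y x i hi.symm]
    exact ⟨⟨fun i hi => hop e x y i (Or.inl (hx.1 i hi)), trivial⟩,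
      ⟨fun i hi => hop e y x i (Or.inr (hx.1 i hi)), trivial⟩⟩

namespace AssBulletStr

variable (S : AssBulletStr (Leib K) V)

/-- The product `≺` as a bilinear map. -/
def leibPrec : V →ₗ[K] V →ₗ[K] V :=
  (S.leibMul.compl₁₂ (LinearMap.inl K (Fin 2 → V) V ∘ₗ LinearMap.single K _ 0)
    (LinearMap.inr K (Fin 2 → V) V)).compr₂ (LinearMap.snd K _ _)

/-- The product `≻` as a bilinear map. -/
def leibSucc : V →ₗ[K] V →ₗ[K] V :=
  -((S.leibMul.compl₁₂ (LinearMap.inl K (Fin 2 → V) V ∘ₗ LinearMap.single K _ 1)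
    (LinearMap.inr K (Fin 2 → V) V)).compr₂ (LinearMap.snd K _ _)).flip

/-- A factor that vanishes at `i` lies in the ideal of cochains relative to `{i}`, so the product
lies there too. -/
theorem leibMul_fst_eq_zero (x y : (Fin 2 → V) × V) (i : Fin 2) (hi : x.1 i = 0 ∨ y.1 i = 0) :
    (S.leibMul x y).1 i = 0 := by
  rcases hi with h | h
  · have hx : x ∈ relCochains K V {i} := ⟨by rintro j rfl; exact h, trivial⟩
    exact (((S.isLocal {i}).2 (leibDot K) x hx y).1).1 i rfl
  · have hy : y ∈ relCochains K V {i} := ⟨by rintro j rfl; exact h, trivial⟩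
    exact (((S.isLocal {i}).2 (leibDot K) y hy x).2).1 i rfl

theorem leibMul_leibniz (f g : Fin 2 → V) :
    (S.leibMul (f, 0) (g, 0)).1 1 - (S.leibMul (f, 0) (g, 0)).1 0
      = (S.leibMul (0, f 1 - f 0) (g, 0)).2 + (S.leibMul (f, 0) (0, g 1 - g 0)).2 :=
  S.pairOp_leibniz (leibDot K) f g

theorem leibMul_left_edge (a b : V) :
    (S.leibMul (Pi.single 0 a, 0) (0, b)).2 = S.leibPrec a b := rfl

theorem leibMul_right_edge (a b : V) :
    (S.leibMul (Pi.single 1 a, 0) (0, b)).2 = -S.leibSucc b a :=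
  (neg_neg _).symm

theorem leibMul_neg_edge (a : V) (y : (Fin 2 → V) × V) :
    S.leibMul (0, -a) y = -S.leibMul (0, a) y := by
  rw [← LinearMap.neg_apply, ← map_neg, Prod.neg_mk, neg_zero]

theorem leibMul_edge_neg (x : (Fin 2 → V) × V) (a : V) :
    S.leibMul x (0, -a) = -S.leibMul x (0, a) := by
  rw [← map_neg, Prod.neg_mk, neg_zero]

/-- Cochains concentrated at opposite vertices have product zero by locality. Their coboundaries are
`-a` and `b`, so the Leibniz rule for this zero product equates edge times right vertex with left
vertex times edge. Exchanging the vertices gives `leibMul_edge_left`. -/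
theorem leibMul_edge_right (a b : V) :
    (S.leibMul (0, a) (Pi.single 1 b, 0)).2 = S.leibPrec a b := by
  have h := S.leibMul_leibniz (Pi.single 0 a) (Pi.single 1 b)
  rw [leibMul_fst_eq_zero _ _ _ _ (Or.inl (by simp)),
    leibMul_fst_eq_zero _ _ _ _ (Or.inr (by simp))] at h
  simp only [Pi.single_eq_same, ne_eq, one_ne_zero, zero_ne_one, not_false_eq_true,
    Pi.single_eq_of_ne, zero_sub, sub_zero, leibMul_neg_edge, leibMul_left_edge, Prod.snd_neg] at h
  exact (neg_add_eq_zero.1 h.symm)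

theorem leibMul_edge_left (a b : V) :
    (S.leibMul (0, a) (Pi.single 0 b, 0)).2 = -S.leibSucc b a := by
  have h := S.leibMul_leibniz (Pi.single 1 a) (Pi.single 0 b)
  rw [leibMul_fst_eq_zero _ _ _ _ (Or.inr (by simp)),
    leibMul_fst_eq_zero _ _ _ _ (Or.inl (by simp))] at h
  simp only [Pi.single_eq_same, ne_eq, one_ne_zero, zero_ne_one, not_false_eq_true,
    Pi.single_eq_of_ne, zero_sub, sub_zero, leibMul_edge_neg, leibMul_right_edge, Prod.snd_neg] at h
  rw [neg_neg] at h
  exact eq_neg_of_add_eq_zero_left h.symm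

/-- By locality only the values at `i` matter, so both factors may be replaced with cochains
concentrated at `i`. Their product vanishes at the other vertex, and its coboundary, computed by the
Leibniz rule, then gives the value at `i`. -/
theorem leibMul_vertex (f g : Fin 2 → V) (i : Fin 2) :
    (S.leibMul (f, 0) (g, 0)).1 i = S.leibPrec (f i) (g i) - S.leibSucc (g i) (f i) := by
  have hf : ((f, 0) : (Fin 2 → V) × V) = (Pi.single i (f i), 0) + (f - Pi.single i (f i), 0) := by
    simp
  have hg : ((g, 0) : (Fin 2 → V) × V) = (Pi.single i (g i), 0) + (g - Pi.single i (g i), 0) := by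
    simp
  have hf' : (S.leibMul (f - Pi.single i (f i), 0) (g, 0)).1 i = 0 :=
    S.leibMul_fst_eq_zero _ _ i (Or.inl (by simp))
  have hg' : (S.leibMul (Pi.single i (f i), 0) (g - Pi.single i (g i), 0)).1 i = 0 :=
    S.leibMul_fst_eq_zero _ _ i (Or.inr (by simp))
  have h : (S.leibMul (f, 0) (g, 0)).1 i
      = (S.leibMul (Pi.single i (f i), 0) (Pi.single i (g i), 0)).1 i := by
    rw [hf, map_add, LinearMap.add_apply, Prod.fst_add, Pi.add_apply, hf', add_zero, hg, map_add,
      Prod.fst_add, Pi.add_apply, hg', add_zero]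
  rw [h]
  have hl := S.leibMul_leibniz (Pi.single i (f i)) (Pi.single i (g i))
  fin_cases i
  · rw [leibMul_fst_eq_zero _ _ _ 1 (Or.inr (by simp))] at hl
    simp only [Fin.zero_eta, Pi.single_eq_same, ne_eq, one_ne_zero, not_false_eq_true,
      Pi.single_eq_of_ne, zero_sub, leibMul_edge_neg, leibMul_neg_edge,
      leibMul_left_edge, leibMul_edge_left, Prod.snd_neg] at hl ⊢
    rw [← neg_inj, hl]
    abel
  · rw [leibMul_fst_eq_zero _ _ _ 0 (Or.inr (by simp))] at hl
    simp only [Fin.mk_one, Pi.single_eq_same, ne_eq, zero_ne_one, not_false_eq_true,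
      Pi.single_eq_of_ne, sub_zero, leibMul_right_edge, leibMul_edge_right] at hl ⊢
    rw [hl]
    abel

theorem leibMul_eq : S.leibMul = intervalMul S.leibPrec S.leibSucc := by
  have hv : ∀ f : Fin 2 → V,
      ((f, 0) : (Fin 2 → V) × V) = (Pi.single 0 (f 0), 0) + (Pi.single 1 (f 1), 0) := by
    intro f
    refine Prod.ext (funext fun i => ?_) (by simp)
    fin_cases i <;> simp
  refine LinearMap.ext₂ ?_
  rintro ⟨f, a⟩ ⟨g, b⟩
  have hx : ((f, a) : (Fin 2 → V) × V) = (f, 0) + (0, a) := by simp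
  have hy : ((g, b) : (Fin 2 → V) × V) = (g, 0) + (0, b) := by simp
  have h₀₁ : ∀ f b, (S.leibMul (f, 0) (0, b)).1 = 0 := S.pairOp_zero_one (leibDot K)
  have h₁₀ : ∀ a g, (S.leibMul (0, a) (g, 0)).1 = 0 := S.pairOp_one_zero (leibDot K)
  have h₀₀ : ∀ f g, (S.leibMul (f, 0) (g, 0)).2 = 0 := S.pairOp_zero_zero (leibDot K)
  have h₁₁ : ∀ a b, S.leibMul (0, a) (0, b) = 0 := S.pairOp_one_one (leibDot K)
  rw [intervalMul_apply]
  refine Prod.ext (funext fun i => ?_) ?_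
  · rw [hx, hy]
    simp only [map_add, LinearMap.add_apply, Prod.fst_add, Pi.add_apply, h₀₁, h₁₀, h₁₁,
      leibMul_vertex]
    simp
  · rw [hx, hy]
    simp only [map_add, LinearMap.add_apply, Prod.snd_add, h₀₀, h₁₁]
    rw [hv f, hv g]
    simp only [map_add, LinearMap.add_apply, Prod.snd_add, leibMul_left_edge, leibMul_right_edge,
      leibMul_edge_left, leibMul_edge_right]
    simp
    abel

theorem isDiAss : IsDiAss S.leibPrec S.leibSucc := by
  have hr := S.leibMul_rel
  rw [S.leibMul_eq] at hr
  have h₀ : ∀ (i : Fin 2) (a : V),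
      (((Pi.single i a : Fin 2 → V), 0) : (Fin 2 → V) × V) ∈ twoTermDeg (K := K) (Fin 2 → V) V 0 :=
    fun i a => ⟨_, rfl⟩
  have h₁ : ∀ a : V, ((0, a) : (Fin 2 → V) × V) ∈ twoTermDeg (K := K) (Fin 2 → V) V 1 :=
    fun a => ⟨a, rfl⟩
  intro x y z
  -- The product of the two opposite vertex cochains is zero, so exactly two of the three terms of
  -- each relation survive. The sixth order (edge, right, left) would only repeat `e₃`.
  have e₁ := congrArg Prod.snd (hr 0 1 0 le_rfl (h₀ 0 x) (h₁ y) (h₀ 1 z))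
  have e₂ := congrArg Prod.snd (hr 0 0 1 le_rfl (h₀ 0 x) (h₀ 1 z) (h₁ y))
  have e₃ := congrArg Prod.snd (hr 1 0 0 le_rfl (h₁ y) (h₀ 0 x) (h₀ 1 z))
  have e₄ := congrArg Prod.snd (hr 0 1 0 le_rfl (h₀ 1 z) (h₁ y) (h₀ 0 x))
  have e₅ := congrArg Prod.snd (hr 0 0 1 le_rfl (h₀ 1 z) (h₀ 0 x) (h₁ y))
  simp only [intervalMul_apply, Prod.snd_add, Pi.single_eq_same, ne_eq, one_ne_zero,
    zero_ne_one, not_false_eq_true, Pi.single_eq_of_ne, Pi.zero_apply, map_zero,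
    LinearMap.zero_apply, map_neg, LinearMap.neg_apply, zero_sub, sub_zero, add_zero, zero_add,
    neg_zero, neg_neg, neg_inj] at e₁ e₂ e₃ e₄ e₅
  have e₂' := neg_add_eq_zero.1 e₂.symm
  have e₅' := neg_add_eq_zero.1 e₅.symm
  exact ⟨e₁, e₁.symm.trans e₂'.symm, e₃, e₅'.trans e₄, e₄.symm⟩

end AssBulletStr

theorem leibMul_assBulletLeib (p s : V →ₗ[K] V →ₗ[K] V) (h : IsDiAss p s) :
    (assBulletLeib p s h).leibMul = intervalMul p s :=
  opLift_gen ![intervalMul p s] 0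

theorem leibPrec_assBulletLeib (p s : V →ₗ[K] V →ₗ[K] V) (h : IsDiAss p s) :
    (assBulletLeib p s h).leibPrec = p := by
  ext x y
  simp [AssBulletStr.leibPrec, leibMul_assBulletLeib, intervalMul_apply]

theorem leibSucc_assBulletLeib (p s : V →ₗ[K] V →ₗ[K] V) (h : IsDiAss p s) :
    (assBulletLeib p s h).leibSucc = s := by
  ext x y
  simp [AssBulletStr.leibSucc, leibMul_assBulletLeib, intervalMul_apply]

theorem assBulletLeib_ext {S T : AssBulletStr (Leib K) V} (hp : S.leibPrec = T.leibPrec)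
    (hs : S.leibSucc = T.leibSucc) : S = T := by
  have h : S.toDGAlg = T.toDGAlg := DGAlg.leib_ext (by rw [S.leibMul_eq, T.leibMul_eq, hp, hs])
  cases S; cases T; cases h; rfl

theorem assBullet_leib_isHom_iff {W : Type v} [AddCommGroup W] [Module K W]
    (S : AssBulletStr (Leib K) V) (T : AssBulletStr (Leib K) W) (f : V →ₗ[K] W) :
    (assBullet.{u, v} (Leib K)).IsHom S T f ↔
      (∀ x y, f (S.leibPrec x y) = T.leibPrec (f x) (f y)) ∧
        ∀ x y, f (S.leibSucc x y) = T.leibSucc (f x) (f y) := by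
  constructor
  · intro h
    have hm : ∀ x y, (f.compLeft (Fin 2)).prodMap f (S.leibMul x y)
        = T.leibMul ((f.compLeft (Fin 2)).prodMap f x) ((f.compLeft (Fin 2)).prodMap f y) :=
      h (leibDot K)
    rw [S.leibMul_eq, T.leibMul_eq] at hm
    refine ⟨fun x y => ?_, fun x y => ?_⟩
    · simpa [intervalMul_apply] using congrArg Prod.snd (hm (Pi.single 0 x, 0) (0, y))
    · simpa [intervalMul_apply] using congrArg Prod.snd (hm (Pi.single 1 y, 0) (0, x))
  · rintro ⟨hp, hs⟩
    refine DGAlg.leib_map_op ((f.compLeft (Fin 2)).prodMap f) ?_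
    rw [S.leibMul_eq, T.leibMul_eq]
    intro x y
    refine Prod.ext (funext fun i => ?_) ?_ <;> simp [intervalMul_apply, hp, hs]

/-- The relations of the products of a diassociative algebra. -/
theorem Alg.isDiAss (T : Alg (DiAss K) V) :
    IsDiAss (Alg.gensOp T (gen K 0)) (Alg.gensOp T (gen K 1)) :=
  (diAssRels_iff (Alg.gensOp_opp T)).1 (Alg.evalTrees_gensOp T)

/-- The identification of `Ass_●(Leib)`-algebras and diassociative algebras. -/
def assBulletLeibIso : AlgType.Iso (assBullet.{u, v} (Leib K)) (algType.{u, v} (DiAss K)) where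
  equiv V _ _ :=
    { toFun := fun S => diAssAlg _ _ (AssBulletStr.isDiAss S)
      invFun := fun T => assBulletLeib _ _ (Alg.isDiAss T)
      left_inv := fun S => assBulletLeib_ext
        ((leibPrec_assBulletLeib _ _ _).trans (opLift_gen _ 0))
        ((leibSucc_assBulletLeib _ _ _).trans (opLift_gen _ 1))
      right_inv := fun T => alg_ext fun i x y => by
        have h : ∀ i : Fin 2, opLift ![(assBulletLeib _ _ (Alg.isDiAss T)).leibPrec,
            (assBulletLeib _ _ (Alg.isDiAss T)).leibSucc] (gen K i) = Alg.gensOp T (gen K i) := by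
          intro i
          rw [opLift_gen]
          fin_cases i
          · exact leibPrec_assBulletLeib _ _ _
          · exact leibSucc_assBulletLeib _ _ _
        exact LinearMap.congr_fun₂ (h i) x y }
  isHom_iff S T f :=
    (assBullet_leib_isHom_iff S T f).trans
      (diAssAlg_isHom_iff (AssBulletStr.isDiAss S) (AssBulletStr.isDiAss T) f).symm

theorem assBulletLeibIso_prec (S : AssBulletStr (Leib K) V) (x y : V) :
    Alg.op (assBulletLeibIso.equiv V S) (diPrec K) x y = S.prec (leibDot K) x y :=
  LinearMap.congr_fun₂ (opLift_gen ![S.leibPrec, S.leibSucc] 0) x y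

theorem assBulletLeibIso_succ (S : AssBulletStr (Leib K) V) (x y : V) :
    Alg.op (assBulletLeibIso.equiv V S) (diSucc K) x y = S.succ (leibDot K) x y :=
  LinearMap.congr_fun₂ (opLift_gen ![S.leibPrec, S.leibSucc] 1) x y

end Interval

/-! ### Trivial associated algebra and permutative algebras -/

section Com

variable {K : Type u} [Field K] {V : Type v} [AddCommGroup V] [Module K V]

/-- In a permutative algebra a product of three letters depends only on its first letter. When `≻`
is the opposite of `≺`, both sides of every diassociative axiom have the same first letter. -/
theorem isDiAss_flip_iff {m : V →ₗ[K] V →ₗ[K] V} : IsDiAss m m.flip ↔ IsPerm m := by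
  refine ⟨fun h x y z => ⟨(h x y z).1, (h x y z).2.1⟩, fun h x y z => ?_⟩
  have h₁ := fun x y z => (h x y z).1
  have h₂ := fun x y z => (h x y z).2
  simp only [LinearMap.flip_apply, h₁, true_and]
  exact ⟨h₂ x y z, h₂ y x z, h₂ z x y, trivial⟩

/-- By `leibMul_vertex` at the right vertex, the associated product of `y` and `x` is `y ≺ x - x ≻
y`. -/
theorem ComBulletStr.leibSucc_eq (S : ComBulletStr (Leib K) V) :
    S.leibSucc = S.leibPrec.flip := by
  ext x y
  have h := S.leibMul_vertex (Pi.single 1 y) (Pi.single 1 x) 1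
  rw [Pi.single_eq_same, Pi.single_eq_same] at h
  exact (sub_eq_zero.1 (h.symm.trans (S.assoc_eq_zero (leibDot K) y x))).symm

theorem ComBulletStr.isPerm (S : ComBulletStr (Leib K) V) : IsPerm S.leibPrec :=
  isDiAss_flip_iff.1 <| by
    have h := S.isDiAss
    rwa [S.leibSucc_eq] at h

/-- The `Com_●(Leib)`-algebra given by a permutative algebra. -/
def comBulletLeib (m : V →ₗ[K] V →ₗ[K] V) (h : IsPerm m) : ComBulletStr (Leib K) V where
  toAssBulletStr := assBulletLeib m m.flip (isDiAss_flip_iff.2 h)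
  assoc_eq_zero := by
    have key : ∀ (e : Gens K 1) (x y : V),
        (opLift ![intervalMul m m.flip] e (Pi.single 1 x, 0) (Pi.single 1 y, 0)).1 1 = 0 := by
      intro e x y
      simp [opLift_apply, intervalMul_apply]
    exact key

theorem comBulletLeib_ext {S T : ComBulletStr (Leib K) V} (h : S.leibPrec = T.leibPrec) :
    S = T := by
  have h' : S.toAssBulletStr = T.toAssBulletStr :=
    assBulletLeib_ext h (by rw [S.leibSucc_eq, T.leibSucc_eq, h])
  cases S; cases T; cases h'; rfl

theorem leibPrec_comBulletLeib (m : V →ₗ[K] V →ₗ[K] V) (h : IsPerm m) :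
    (comBulletLeib m h).leibPrec = m :=
  leibPrec_assBulletLeib _ _ (isDiAss_flip_iff.2 h)

/-- The relations of the product of a permutative algebra. -/
theorem Alg.isPerm (T : Alg (PermOp K) V) : IsPerm (Alg.gensOp T (gen K 0)) :=
  (permRels_iff (Alg.gensOp_opp T)).1 (Alg.evalTrees_gensOp T)

theorem comBullet_leib_isHom_iff {W : Type v} [AddCommGroup W] [Module K W]
    (S : ComBulletStr (Leib K) V) (T : ComBulletStr (Leib K) W) (f : V →ₗ[K] W) :
    (comBullet.{u, v} (Leib K)).IsHom S T f ↔
      ∀ x y, f (S.leibPrec x y) = T.leibPrec (f x) (f y) := by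
  refine (assBullet_leib_isHom_iff S.toAssBulletStr T.toAssBulletStr f).trans
    ⟨fun h => h.1, fun h => ⟨h, fun x y => ?_⟩⟩
  rw [S.leibSucc_eq, T.leibSucc_eq]
  exact h y x

/-- The identification of `Com_●(Leib)`-algebras and permutative algebras. -/
def comBulletLeibIso : AlgType.Iso (comBullet.{u, v} (Leib K)) (algType.{u, v} (PermOp K)) where
  equiv V _ _ :=
    { toFun := fun S => permAlg _ (ComBulletStr.isPerm S)
      invFun := fun T => comBulletLeib _ (Alg.isPerm T)
      left_inv := fun S => comBulletLeib_ext
        ((leibPrec_comBulletLeib _ _).trans (opLift_gen _ 0))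
      right_inv := fun T => alg_ext fun i x y => by
        have h : ∀ i : Fin 1, opLift ![(comBulletLeib _ (Alg.isPerm T)).leibPrec] (gen K i)
            = Alg.gensOp T (gen K i) := by
          intro i
          rw [opLift_gen]
          fin_cases i
          exact leibPrec_comBulletLeib _ _
        exact LinearMap.congr_fun₂ (h i) x y }
  isHom_iff S T f :=
    (comBullet_leib_isHom_iff S T f).trans
      (permAlg_isHom_iff (ComBulletStr.isPerm S) (ComBulletStr.isPerm T) f).symm

theorem comBulletLeibIso_prec (S : ComBulletStr (Leib K) V) (x y : V) :
    Alg.op (comBulletLeibIso.equiv V S) (permDot K) x y = S.prec (leibDot K) x y :=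
  LinearMap.congr_fun₂ (opLift_gen ![S.leibPrec] 0) x y

theorem comBulletLeibIso_succ (S : ComBulletStr (Leib K) V) (x y : V) :
    Alg.op (comBulletLeibIso.equiv V S) (permDot K) x y = S.succ (leibDot K) y x :=
  (comBulletLeibIso_prec S x y).trans (LinearMap.congr_fun₂ S.leibSucc_eq y x).symm

end Com

/-! ### Dg Leibniz structures relative to the left vertex -/

section PreLie

variable {K : Type u} [Field K] {V : Type v} [AddCommGroup V] [Module K V]

variable (K V) in
/-- The inclusion of the coefficients as `0`-cochains at the right vertex. -/
def rightVertex : V →ₗ[K] vanishingOn K V {0} :=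
  (LinearMap.single K (fun _ : Fin 2 => V) 1).codRestrict _ (by rintro x i rfl; simp)

theorem rightVertex_apply_one (x : V) : (rightVertex K V x).1 1 = x :=
  Pi.single_eq_same (M := fun _ : Fin 2 => V) 1 x

theorem rightVertex_eq (f : vanishingOn K V {0}) : rightVertex K V (f.1 1) = f := by
  refine Subtype.ext (funext fun i => ?_)
  fin_cases i
  · exact (f.2 0 rfl).symm
  · exact rightVertex_apply_one _

/-- A relative 0-cochain amounts to its value at the right vertex. The differential is therefore an
isomorphism from degree zero to degree one, which is why the edge products determine the product of
0-cochains. -/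
theorem coboundary_eq (f : vanishingOn K V {0}) :
    (coboundary K V).domRestrict (vanishingOn K V {0}) f = f.1 1 := by
  have h : f.1 0 = 0 := f.2 0 rfl
  simp [coboundary, h]

/-- The product of cochains on the interval relative to the left vertex which is determined by two
products `≺`, `≻` on the coefficients. -/
def relIntervalMul (p s : V →ₗ[K] V →ₗ[K] V) :
    vanishingOn K V {0} × V →ₗ[K] vanishingOn K V {0} × V →ₗ[K] vanishingOn K V {0} × V :=
  LinearMap.mk₂ K
    (fun x y => (rightVertex K V (p (x.1.1 1) (y.1.1 1) - s (y.1.1 1) (x.1.1 1)),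
      p x.2 (y.1.1 1) - s y.2 (x.1.1 1)))
    (fun x x' y => by
      refine Prod.ext ?_ ?_ <;> simp <;> abel)
    (fun c x y => by
      refine Prod.ext ?_ ?_ <;> simp [smul_sub])
    (fun x x' y => by
      refine Prod.ext ?_ ?_ <;> simp <;> abel)
    (fun c x y => by
      refine Prod.ext ?_ ?_ <;> simp [smul_sub])

theorem relIntervalMul_apply (p s : V →ₗ[K] V →ₗ[K] V) (x y : vanishingOn K V {0} × V) :
    relIntervalMul p s x y = (rightVertex K V (p (x.1.1 1) (y.1.1 1) - s (y.1.1 1) (x.1.1 1)),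
      p x.2 (y.1.1 1) - s y.2 (x.1.1 1)) :=
  rfl

theorem isLeib_relIntervalMul {p s : V →ₗ[K] V →ₗ[K] V} (h : IsPreLieLeib p s) :
    IsLeib (relIntervalMul p s) := by
  -- The relations are solved for `x ≺ (y ≺ z)`, `(x ≻ y) ≻ z` and `x ≻ (y ≺ z)`, so that rewriting
  -- removes these monomials and the rest cancels.
  have h₁ := fun x y z => sub_eq_iff_eq_add.1 (h x y z).1
  have h₂ := fun x y z => (h x y z).2.1
  have h₃ := fun x y z => sub_eq_iff_eq_add.1 (h x y z).2.2
  intro x y z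
  refine Prod.ext ?_ ?_ <;>
    simp only [relIntervalMul_apply, rightVertex_apply_one, Prod.fst_add, Prod.snd_add,
      ← map_add]
  · refine congrArg _ ?_
    simp only [map_sub, LinearMap.sub_apply, h₁, h₂, h₃]
    abel
  · simp only [map_sub, LinearMap.sub_apply, h₁, h₂, h₃]
    abel

/-- The dg Leibniz algebra structure on relative cochains given by two products. -/
def preLieBulletLeib (p s : V →ₗ[K] V →ₗ[K] V) (h : IsPreLieLeib p s) :
    PreLieBulletStr (Leib K) V :=
  dgLeib (relIntervalMul p s) (isLeib_relIntervalMul h)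
    (fun x y => by simp [relIntervalMul_apply])
    (fun x y => by simp [relIntervalMul_apply])
    (fun x y => by simp [relIntervalMul_apply])
    (fun x y => by simp [relIntervalMul_apply])
    (fun x y => by
      simp only [coboundary_eq, relIntervalMul_apply, rightVertex_apply_one, map_zero,
        LinearMap.zero_apply, sub_zero, zero_sub]
      exact sub_eq_add_neg _ _)

/-- The product `≺` of a dg Leibniz algebra structure on relative cochains, as a bilinear map. -/
def relLeibPrec (S : PreLieBulletStr (Leib K) V) : V →ₗ[K] V →ₗ[K] V :=
  ((DGAlg.leibMul S).compl₁₂ (LinearMap.inr K (vanishingOn K V {0}) V)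
    (LinearMap.inl K (vanishingOn K V {0}) V ∘ₗ rightVertex K V)).compr₂ (LinearMap.snd K _ _)

/-- The product `≻` of a dg Leibniz algebra structure on relative cochains, as a bilinear map. -/
def relLeibSucc (S : PreLieBulletStr (Leib K) V) : V →ₗ[K] V →ₗ[K] V :=
  -(((DGAlg.leibMul S).compl₁₂ (LinearMap.inl K (vanishingOn K V {0}) V ∘ₗ rightVertex K V)
    (LinearMap.inr K (vanishingOn K V {0}) V)).compr₂ (LinearMap.snd K _ _)).flip

/-- The edge products are `≺` and `≻` by definition. The product of 0-cochains is recovered from its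
coboundary, which the Leibniz rule writes through the edge products. -/
theorem leibMul_eq_relIntervalMul (S : PreLieBulletStr (Leib K) V) :
    DGAlg.leibMul S = relIntervalMul (relLeibPrec S) (relLeibSucc S) := by
  have h₀₁ : ∀ f b, (DGAlg.leibMul S (f, 0) (0, b)).1 = 0 := DGAlg.pairOp_zero_one S (leibDot K)
  have h₁₀ : ∀ a g, (DGAlg.leibMul S (0, a) (g, 0)).1 = 0 := DGAlg.pairOp_one_zero S (leibDot K)
  have h₀₀ : ∀ f g, (DGAlg.leibMul S (f, 0) (g, 0)).2 = 0 := DGAlg.pairOp_zero_zero S (leibDot K)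
  have h₁₁ : ∀ a b, DGAlg.leibMul S (0, a) (0, b) = 0 := DGAlg.pairOp_one_one S (leibDot K)
  have hl : ∀ f b, (DGAlg.leibMul S (f, 0) (0, b)).2 = -relLeibSucc S b (f.1 1) := by
    intro f b
    conv_lhs => rw [← rightVertex_eq f]
    exact (neg_neg _).symm
  have hr : ∀ a g, (DGAlg.leibMul S (0, a) (g, 0)).2 = relLeibPrec S a (g.1 1) := by
    intro a g
    conv_lhs => rw [← rightVertex_eq g]
    rfl
  have hv : ∀ f g, (DGAlg.leibMul S (f, 0) (g, 0)).1
      = rightVertex K V (relLeibPrec S (f.1 1) (g.1 1) - relLeibSucc S (g.1 1) (f.1 1)) := by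
    intro f g
    have h := DGAlg.pairOp_leibniz S (leibDot K) f g
    rw [coboundary_eq, coboundary_eq, coboundary_eq] at h
    rw [← rightVertex_eq (DGAlg.leibMul S (f, 0) (g, 0)).1, sub_eq_add_neg, ← hr, ← hl]
    exact congrArg _ h
  refine LinearMap.ext₂ ?_
  rintro ⟨f, a⟩ ⟨g, b⟩
  have hx : ((f, a) : vanishingOn K V {0} × V) = (f, 0) + (0, a) := by simp
  have hy : ((g, b) : vanishingOn K V {0} × V) = (g, 0) + (0, b) := by simp
  rw [relIntervalMul_apply, hx, hy]
  refine Prod.ext ?_ ?_ <;>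
    simp only [map_add, LinearMap.add_apply, Prod.fst_add, Prod.snd_add, h₀₀, h₀₁, h₁₀, h₁₁, hv, hl,
      hr] <;> simp [sub_eq_add_neg]

theorem isPreLieLeib (S : PreLieBulletStr (Leib K) V) :
    IsPreLieLeib (relLeibPrec S) (relLeibSucc S) := by
  have hr := DGAlg.leibMul_rel S
  rw [leibMul_eq_relIntervalMul] at hr
  have h₀ : ∀ a : V, ((rightVertex K V a, 0) : vanishingOn K V {0} × V)
      ∈ twoTermDeg (K := K) (vanishingOn K V {0}) V 0 := fun a => ⟨_, rfl⟩
  have h₁ : ∀ a : V, ((0, a) : vanishingOn K V {0} × V)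
      ∈ twoTermDeg (K := K) (vanishingOn K V {0}) V 1 := fun a => ⟨a, rfl⟩
  intro x y z
  -- The edge argument `x` is placed first, second and third. The second position is used with both
  -- orders of `y` and `z`.
  have e₁ := congrArg Prod.snd (hr 1 0 0 le_rfl (h₁ x) (h₀ y) (h₀ z))
  have e₂ := congrArg Prod.snd (hr 0 1 0 le_rfl (h₀ y) (h₁ x) (h₀ z))
  have e₃ := congrArg Prod.snd (hr 0 1 0 le_rfl (h₀ z) (h₁ x) (h₀ y))
  have e₄ := congrArg Prod.snd (hr 0 0 1 le_rfl (h₀ z) (h₀ y) (h₁ x))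
  simp [relIntervalMul_apply, rightVertex_apply_one] at e₁ e₂ e₃ e₄
  refine ⟨?_, ?_, ?_⟩
  · linear_combination (norm := module) (-1 : K) • e₁
  -- Adding the two relations cancels `(x ≻ z) ≺ y` and `x ≻ (z · y)`, leaving `(x ≻ y) ≻ z = (x ≺
  -- y) ≻ z`.
  · linear_combination (norm := module) (-1 : K) • e₃ + (-1 : K) • e₄
  · linear_combination (norm := module) (1 : K) • e₂

theorem leibMul_preLieBulletLeib (p s : V →ₗ[K] V →ₗ[K] V) (h : IsPreLieLeib p s) :
    DGAlg.leibMul (preLieBulletLeib p s h) = relIntervalMul p s :=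
  opLift_gen ![relIntervalMul p s] 0

theorem relLeibPrec_preLieBulletLeib (p s : V →ₗ[K] V →ₗ[K] V) (h : IsPreLieLeib p s) :
    relLeibPrec (preLieBulletLeib p s h) = p := by
  ext x y
  simp [relLeibPrec, leibMul_preLieBulletLeib, relIntervalMul_apply, rightVertex_apply_one]

theorem relLeibSucc_preLieBulletLeib (p s : V →ₗ[K] V →ₗ[K] V) (h : IsPreLieLeib p s) :
    relLeibSucc (preLieBulletLeib p s h) = s := by
  ext x y
  simp [relLeibSucc, leibMul_preLieBulletLeib, relIntervalMul_apply, rightVertex_apply_one]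

theorem preLieBulletLeib_ext {S T : PreLieBulletStr (Leib K) V} (hp : relLeibPrec S = relLeibPrec T)
    (hs : relLeibSucc S = relLeibSucc T) : S = T :=
  DGAlg.leib_ext (by rw [leibMul_eq_relIntervalMul S, leibMul_eq_relIntervalMul T, hp, hs])

theorem preLieBullet_leib_isHom_iff {W : Type v} [AddCommGroup W] [Module K W]
    (S : PreLieBulletStr (Leib K) V) (T : PreLieBulletStr (Leib K) W) (f : V →ₗ[K] W) :
    (preLieBullet.{u, v} (Leib K)).IsHom S T f ↔
      (∀ x y, f (relLeibPrec S x y) = relLeibPrec T (f x) (f y)) ∧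
        ∀ x y, f (relLeibSucc S x y) = relLeibSucc T (f x) (f y) := by
  let F : vanishingOn K V {0} × V →ₗ[K] vanishingOn K W {0} × W := leftRelCochainsMap K f
  have hF₁ : ∀ x, (F x).1.1 1 = f (x.1.1 1) := fun x => rfl
  have hF₂ : ∀ x, (F x).2 = f x.2 := fun x => rfl
  constructor
  · intro h
    have hm : ∀ x y, F (DGAlg.leibMul S x y) = DGAlg.leibMul T (F x) (F y) := h (leibDot K)
    rw [leibMul_eq_relIntervalMul S, leibMul_eq_relIntervalMul T] at hm
    refine ⟨fun x y => ?_, fun x y => ?_⟩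
    · simpa [relIntervalMul_apply, hF₁, hF₂, rightVertex_apply_one] using
        congrArg Prod.snd (hm (0, x) (rightVertex K V y, 0))
    · simpa [relIntervalMul_apply, hF₁, hF₂, rightVertex_apply_one] using
        congrArg Prod.snd (hm (rightVertex K V y, 0) (0, x))
  · rintro ⟨hp, hs⟩
    refine DGAlg.leib_map_op F ?_
    rw [leibMul_eq_relIntervalMul S, leibMul_eq_relIntervalMul T]
    intro x y
    refine Prod.ext ?_ ?_
    · rw [← rightVertex_eq (F _).1, hF₁]
      simp [relIntervalMul_apply, hF₁, rightVertex_apply_one, hp, hs]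
    · simp [relIntervalMul_apply, hF₁, hF₂, hp, hs]

/-- The relations of the products of an algebra over `PreLieLeib`. -/
theorem Alg.isPreLieLeib (T : Alg (PreLieLeib K) V) :
    IsPreLieLeib (Alg.gensOp T (gen K 0)) (Alg.gensOp T (gen K 1)) :=
  (preLieLeibRels'_iff (Alg.gensOp_opp T)).1 (Alg.evalTrees_gensOp T)

/-- The identification of `preLie_●(Leib)`-algebras and algebras over `PreLieLeib`. -/
def preLieBulletLeibIso :
    AlgType.Iso (preLieBullet.{u, v} (Leib K)) (algType.{u, v} (PreLieLeib K)) where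
  equiv V _ _ :=
    { toFun := fun S => preLieLeibAlg _ _ (isPreLieLeib S)
      invFun := fun T => preLieBulletLeib _ _ (Alg.isPreLieLeib T)
      left_inv := fun S => preLieBulletLeib_ext
        ((relLeibPrec_preLieBulletLeib _ _ _).trans (opLift_gen _ 0))
        ((relLeibSucc_preLieBulletLeib _ _ _).trans (opLift_gen _ 1))
      right_inv := fun T => alg_ext fun i x y => by
        have h : ∀ i : Fin 2, opLift ![relLeibPrec (preLieBulletLeib _ _ (Alg.isPreLieLeib T)),
            relLeibSucc (preLieBulletLeib _ _ (Alg.isPreLieLeib T))] (gen K i)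
              = Alg.gensOp T (gen K i) := by
          intro i
          rw [opLift_gen]
          fin_cases i
          · exact relLeibPrec_preLieBulletLeib _ _ _
          · exact relLeibSucc_preLieBulletLeib _ _ _
        exact LinearMap.congr_fun₂ (h i) x y }
  isHom_iff S T f :=
    (preLieBullet_leib_isHom_iff S T f).trans
      (preLieLeibAlg_isHom_iff (isPreLieLeib S) (isPreLieLeib T) f).symm

theorem preLieBulletLeibIso_prec (S : PreLieBulletStr (Leib K) V) (x y : V) :
    Alg.op (preLieBulletLeibIso.equiv V S) (plPrec K) x y = preLieBulletPrec S (leibDot K) x y :=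
  LinearMap.congr_fun₂ (opLift_gen ![relLeibPrec S, relLeibSucc S] 0) x y

theorem preLieBulletLeibIso_succ (S : PreLieBulletStr (Leib K) V) (x y : V) :
    Alg.op (preLieBulletLeibIso.equiv V S) (plSucc K) x y = preLieBulletSucc S (leibDot K) x y :=
  LinearMap.congr_fun₂ (opLift_gen ![relLeibPrec S, relLeibSucc S] 1) x y

end PreLie

/-! ### Relators with permuted arguments -/

section Permutations

variable {K : Type u} [Field K] {E : Type*} [AddCommGroup E] [Module K E] {τ : E →ₗ[K] E}

theorem rot_single (i : Fin 3) (t : E ⊗[K] E) :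
    rot K E (Pi.single i t) = Pi.single (i + 2) t := by
  have h : ∀ i u : Fin 3, u + 1 = i ↔ u = i + 2 := by decide
  funext u
  simp only [rot, LinearMap.pi_apply, LinearMap.proj_apply, Pi.single_apply, h]

theorem swap_single (i : Fin 3) (t : E ⊗[K] E) :
    swap K τ (Pi.single i t) = Pi.single (-i) (LinearMap.lTensor E τ t) := by
  have h : ∀ i u : Fin 3, -u = i ↔ u = -i := by decide
  funext u
  simp only [swap, LinearMap.pi_apply, LinearMap.comp_apply, LinearMap.proj_apply, Pi.single_apply,
    h]
  split_ifs <;> simp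

theorem rot_leftComb (a b : E) (i j k : Fin 3) :
    rot K E (leftComb K τ a b i j k) = leftComb K τ a b (i + 2) (j + 2) (k + 2) := by
  have h : ∀ i j : Fin 3, j = i + 1 ↔ j + 2 = i + 2 + 1 := by decide
  unfold leftComb
  simp only [← h]
  split_ifs <;> rw [rot_single]

theorem swap_leftComb (hτ : ∀ e, τ (τ e) = e) (a b : E) (i j k : Fin 3) (hij : i ≠ j) :
    swap K τ (leftComb K τ a b i j k) = leftComb K τ a b (1 - i) (1 - j) (1 - k) := by
  have h : ∀ i j : Fin 3, i ≠ j → (1 - j = 1 - i + 1 ↔ j ≠ i + 1) := by decide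
  have h₁ : ∀ i j : Fin 3, j = i + 1 → -i = 1 - j := by decide
  have h₂ : ∀ i j : Fin 3, i ≠ j → j ≠ i + 1 → -j = 1 - i := by decide
  unfold leftComb
  simp only [h i j hij]
  by_cases hj : j = i + 1
  · rw [if_pos hj, if_neg (not_not.2 hj), swap_single, h₁ i j hj, LinearMap.lTensor_tmul]
  · rw [if_neg hj, if_pos hj, swap_single, h₂ i j hij hj, LinearMap.lTensor_tmul, hτ]

theorem rot_rightComb (a b : E) (i j k : Fin 3) :
    rot K E (rightComb K τ a b i j k) = rightComb K τ a b (i + 2) (j + 2) (k + 2) :=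
  rot_leftComb _ _ _ _ _

theorem swap_rightComb (hτ : ∀ e, τ (τ e) = e) (a b : E) (i j k : Fin 3) (hjk : j ≠ k) :
    swap K τ (rightComb K τ a b i j k) = rightComb K τ a b (1 - i) (1 - j) (1 - k) :=
  swap_leftComb hτ _ _ _ _ _ hjk

/-- The triples which are permutations of `(0, 1, 2)`. -/
abbrev Distinct (i j k : Fin 3) : Prop := i ≠ j ∧ i ≠ k ∧ j ≠ k

variable (K τ) in
/-- A relator depending on three arguments is natural if permutations act on it by permuting the
arguments. -/
structure IsNatural (r : Fin 3 → Fin 3 → Fin 3 → Trees K E) : Prop where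
  rot : ∀ i j k, rot K E (r i j k) = r (i + 2) (j + 2) (k + 2)
  swap : ∀ i j k, Distinct i j k → swap K τ (r i j k) = r (1 - i) (1 - j) (1 - k)

theorem IsNatural.sub {r s : Fin 3 → Fin 3 → Fin 3 → Trees K E} (hr : IsNatural K τ r)
    (hs : IsNatural K τ s) : IsNatural K τ fun i j k => r i j k - s i j k :=
  ⟨fun i j k => by rw [map_sub, hr.rot, hs.rot],
    fun i j k h => by rw [map_sub, hr.swap _ _ _ h, hs.swap _ _ _ h]⟩

theorem IsNatural.add {r s : Fin 3 → Fin 3 → Fin 3 → Trees K E} (hr : IsNatural K τ r)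
    (hs : IsNatural K τ s) : IsNatural K τ fun i j k => r i j k + s i j k :=
  ⟨fun i j k => by rw [map_add, hr.rot, hs.rot],
    fun i j k h => by rw [map_add, hr.swap _ _ _ h, hs.swap _ _ _ h]⟩

theorem IsNatural.neg {r : Fin 3 → Fin 3 → Fin 3 → Trees K E} (hr : IsNatural K τ r) :
    IsNatural K τ fun i j k => -r i j k :=
  ⟨fun i j k => by rw [map_neg, hr.rot], fun i j k h => by rw [map_neg, hr.swap _ _ _ h]⟩

theorem IsNatural.flip {r : Fin 3 → Fin 3 → Fin 3 → Trees K E} (hr : IsNatural K τ r) :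
    IsNatural K τ fun i j k => r i k j :=
  ⟨fun i j k => hr.rot i k j, fun i j k h => hr.swap i k j ⟨h.2.1, h.1, h.2.2.symm⟩⟩

theorem IsNatural.cycle {r : Fin 3 → Fin 3 → Fin 3 → Trees K E} (hr : IsNatural K τ r) :
    IsNatural K τ fun i j k => r j k i :=
  ⟨fun i j k => hr.rot j k i, fun i j k h => hr.swap j k i ⟨h.2.2, h.1.symm, h.2.1.symm⟩⟩

theorem IsNatural.exchange {r : Fin 3 → Fin 3 → Fin 3 → Trees K E} (hr : IsNatural K τ r) :
    IsNatural K τ fun i j k => r j i k :=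
  ⟨fun i j k => hr.rot j i k, fun i j k h => hr.swap j i k ⟨h.1.symm, h.2.2, h.2.1⟩⟩

theorem isNatural_leftComb (hτ : ∀ e, τ (τ e) = e) (a b : E) :
    IsNatural K τ (leftComb K τ a b) :=
  ⟨rot_leftComb a b, fun i j k h => swap_leftComb hτ a b i j k h.1⟩

theorem isNatural_rightComb (hτ : ∀ e, τ (τ e) = e) (a b : E) :
    IsNatural K τ (rightComb K τ a b) :=
  ⟨rot_rightComb a b, fun i j k h => swap_rightComb hτ a b i j k h.2.2⟩

/-- The transposition and the rotations generate the symmetric group, so the orbit of `r 0 1 2`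
contains all six permuted relators. -/
theorem IsNatural.mem {r : Fin 3 → Fin 3 → Fin 3 → Trees K E} (hr : IsNatural K τ r)
    {R : Submodule K (Trees K E)} (hR : IsStable K τ R) (h : r 0 1 2 ∈ R) (i j k : Fin 3)
    (hd : Distinct i j k) : r i j k ∈ R := by
  have hrot : ∀ {i j k}, r i j k ∈ R → r (i + 2) (j + 2) (k + 2) ∈ R := fun {i j k} hm => by
    rw [← hr.rot]; exact (hR _ hm).1
  have h' : r 1 0 2 ∈ R := by
    have h₁ := (hR _ h).2
    rwa [hr.swap 0 1 2 (by decide)] at h₁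
  have h₁ := hrot h
  have h₂ := hrot h₁
  have h₁' := hrot h'
  have h₂' := hrot h₁'
  fin_cases i <;> fin_cases j <;> fin_cases k <;> first | exact absurd hd (by decide) | assumption

/-- The span of the six permuted relators is already invariant. Hence `R` itself need not be stable,
which matters when it is a preimage under the pairing with a fixed vector. -/
theorem IsNatural.relClosure_le {r : Fin 3 → Fin 3 → Fin 3 → Trees K E} (hr : IsNatural K τ r)
    {R : Submodule K (Trees K E)} (h : ∀ i j k, Distinct i j k → r i j k ∈ R) :
    relClosure K τ {r 0 1 2} ≤ R := by
  have hd₁ : ∀ i j k : Fin 3, Distinct i j k → Distinct (i + 2) (j + 2) (k + 2) := by decide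
  have hd₂ : ∀ i j k : Fin 3, Distinct i j k → Distinct (1 - i) (1 - j) (1 - k) := by decide
  let s : Set (Trees K E) := {a | ∃ i j k, Distinct i j k ∧ a = r i j k}
  have hs : Submodule.span K s ≤ R :=
    Submodule.span_le.2 (by rintro _ ⟨i, j, k, hd, rfl⟩; exact h i j k hd)
  refine (BinaryOperad.relClosure_le K τ _ (Submodule.span K s) ?_ ?_).trans hs
  · have h₁ : Submodule.span K s ≤ (Submodule.span K s).comap (BinaryOperad.rot K E) := by
      refine Submodule.span_le.2 ?_
      rintro _ ⟨i, j, k, hd, rfl⟩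
      exact Submodule.subset_span ⟨_, _, _, hd₁ i j k hd, hr.rot i j k⟩
    have h₂ : Submodule.span K s ≤ (Submodule.span K s).comap (BinaryOperad.swap K τ) := by
      refine Submodule.span_le.2 ?_
      rintro _ ⟨i, j, k, hd, rfl⟩
      exact Submodule.subset_span ⟨_, _, _, hd₂ i j k hd, hr.swap i j k hd⟩
    exact fun a ha => ⟨h₁ ha, h₂ ha⟩
  · rintro _ rfl
    exact Submodule.subset_span ⟨0, 1, 2, by decide, rfl⟩

end Permutations

/-! ### The two presentations of the pre-Lie construction -/

section PreLieRelators

variable {K : Type u} [Field K] {n : ℕ}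

theorem isNatural_lm (a b : Gens K n) : IsNatural K (opp K n) (lm a b) :=
  isNatural_leftComb (fun _ => rfl) a b

theorem isNatural_rm (a b : Gens K n) : IsNatural K (opp K n) (rm a b) :=
  isNatural_rightComb (fun _ => rfl) a b

/-- The first relators differ by a sign, and the second unprimed relator is the third primed one
with `x` and `y` exchanged. The sum of the second and third unprimed relators, with arguments
permuted to match, is minus the second primed one, because `(x ≻ z) ≺ y` and `x ≻ (z · y)` cancel.
-/
theorem relClosure_preLieLeibRels :
    relClosure K (opp K 2) (preLieLeibRels K) = relClosure K (opp K 2) (preLieLeibRels' K) := by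
  have lm' := fun i j => isNatural_lm (K := K) (gen K i : Gens K 2) (gen K j)
  have rm' := fun i j => isNatural_rm (K := K) (gen K i : Gens K 2) (gen K j)
  refine le_antisymm (relClosure_le _ _ _ _ (relClosure_stable _ _ _) ?_)
    (relClosure_le _ _ _ _ (relClosure_stable _ _ _) ?_)
  · have hst := relClosure_stable K (opp K 2) (preLieLeibRels' K)
    have hs := subset_relClosure K (opp K 2) (preLieLeibRels' K)
    have h₁ := SetLike.mem_coe.1 (hs (Or.inl rfl))
    have h₂ := IsNatural.mem ((lm' 1 1).sub (lm' 0 1)) hst (hs (Or.inr (Or.inl rfl)))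
    have h₃ := IsNatural.mem (((rm' 1 0).sub (rm' 1 1).flip).sub ((lm' 1 0).sub (lm' 0 1).flip)) hst
      (hs (Or.inr (Or.inr rfl)))
    rintro _ (rfl | rfl | rfl) <;> refine SetLike.mem_coe.2 ?_
    · refine (Submodule.neg_mem_iff _).1 ?_
      convert h₁ using 1
      abel
    · convert h₃ 1 0 2 (by decide) using 1
      abel
    · convert neg_mem (add_mem (h₃ 2 0 1 (by decide))
        (h₂ 2 1 0 (by decide))) using 1
      abel
  · have hst := relClosure_stable K (opp K 2) (preLieLeibRels K)
    have hs := subset_relClosure K (opp K 2) (preLieLeibRels K)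
    have h₁ := SetLike.mem_coe.1 (hs (Or.inl rfl))
    -- `exchange` and `cycle` rename the arguments so that the value at `0 1 2` is the listed
    -- relator.
    have h₂ := IsNatural.mem (((lm' 1 0).exchange.neg.add (lm' 0 1).cycle).add
      ((rm' 1 0).exchange.sub (rm' 1 1).cycle)) hst (hs (Or.inr (Or.inl rfl)))
    have h₃ := IsNatural.mem ((((rm' 1 0).cycle.cycle.sub (rm' 1 1).exchange.cycle).neg.sub
      (lm' 1 1).exchange.cycle).add (lm' 1 0).cycle.cycle) hst (hs (Or.inr (Or.inr rfl)))
    rintro _ (rfl | rfl | rfl) <;> refine SetLike.mem_coe.2 ?_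
    · refine (Submodule.neg_mem_iff _).1 ?_
      convert h₁ using 1
      abel
    · convert neg_mem (add_mem (h₂ 2 0 1 (by decide)) (h₃ 2 1 0 (by decide))) using 1
      abel
    · convert h₂ 1 0 2 (by decide) using 1
      abel

end PreLieRelators

/-! ### Relators of a black product, and the case of `Lie` -/

section BlackProduct

variable {K : Type u} [Field K]

theorem rot_rot_rot {E : Type*} [AddCommGroup E] [Module K E] (a : Trees K E) :
    rot K E (rot K E (rot K E a)) = a := by
  have h : ∀ u : Fin 3, u + 1 + 1 + 1 = u := by decide
  funext u
  exact congrArg a (h u)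

theorem swap_swap {E : Type*} [AddCommGroup E] [Module K E] {τ : E →ₗ[K] E}
    (hτ : ∀ e, τ (τ e) = e) (a : Trees K E) : swap K τ (swap K τ a) = a := by
  have hττ : τ ∘ₗ τ = LinearMap.id := LinearMap.ext hτ
  funext u
  simp only [swap, LinearMap.pi_apply, LinearMap.comp_apply, LinearMap.proj_apply, neg_neg]
  rw [← LinearMap.lTensor_comp_apply, hττ, LinearMap.lTensor_id, LinearMap.id_apply]

/-- To map the relators of a black product to a stable space of relators, it suffices to consider a
generating relator of the first factor and the permutations of one of the second factor. -/
theorem map_relClosure_black_le {E F G : Type*} [AddCommGroup E] [Module K E] [AddCommGroup F]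
    [Module K F] [AddCommGroup G] [Module K G] {τ : E →ₗ[K] E} {σ : F →ₗ[K] F} {ρ : G →ₗ[K] G}
    (hσ : ∀ e, σ (σ e) = e) {f : E ⊗[K] F →ₗ[K] G}
    (hf : ∀ e, f ((-TensorProduct.map τ σ) e) = ρ (f e)) {D : Submodule K (Trees K G)}
    (hD : IsStable K ρ D) {a₀ : Trees K E} {r : Fin 3 → Fin 3 → Fin 3 → Trees K F}
    (hr : IsNatural K σ r)
    (h : ∀ i j k, Distinct i j k → mapTrees K f (blackPairing E F a₀ (r i j k)) ∈ D)
    {c : Trees K (E ⊗[K] F)}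
    (hc : c ∈ Submodule.map₂ (blackPairing E F) (relClosure K τ {a₀}) (relClosure K σ {r 0 1 2})) :
    mapTrees K f c ∈ D := by
  have hL := relClosure_stable K σ {r 0 1 2}
  -- For fixed `a₀` the preimage of `D` is not assumed invariant, so all six permutations of the
  -- second relator are checked.
  have h₀ : ∀ b ∈ relClosure K σ {r 0 1 2}, mapTrees K f (blackPairing E F a₀ b) ∈ D := by
    have := hr.relClosure_le (R := D.comap (mapTrees K f ∘ₗ blackPairing E F a₀)) h
    exact fun b hb => this hb
  let S : Submodule K (Trees K E) :=
    ⨅ b ∈ relClosure K σ {r 0 1 2}, D.comap (mapTrees K f ∘ₗ (blackPairing E F).flip b)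
  have hS : ∀ a, a ∈ S ↔
      ∀ b ∈ relClosure K σ {r 0 1 2}, mapTrees K f (blackPairing E F a b) ∈ D := by
    intro a
    simp only [S, Submodule.mem_iInf, Submodule.mem_comap]
    rfl
  -- A permutation of the first factor alone equals, up to sign, the same permutation of the whole
  -- pairing after its inverse has acted on the second factor. The relators of the second factor and
  -- `D` are both invariant.
  have hτ : IsStable K τ S := by
    intro a ha
    rw [hS] at ha
    refine ⟨(hS _).2 fun b hb => ?_, (hS _).2 fun b hb => ?_⟩
    · rw [← rot_rot_rot b, ← blackPairing_rot, mapTrees_rot]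
      exact (hD _ (ha _ (hL _ (hL _ hb).1).1)).1
    · rw [← swap_swap hσ b, ← neg_neg (blackPairing E F _ _), ← blackPairing_swap, map_neg,
        mapTrees_swap _ ρ f hf]
      exact neg_mem (hD _ (ha _ (hL _ hb).2)).2
  have hle : relClosure K τ {a₀} ≤ S :=
    relClosure_le K τ _ S hτ (Set.singleton_subset_iff.2 ((hS a₀).2 h₀))
  have hmap : Submodule.map₂ (blackPairing E F) (relClosure K τ {a₀}) (relClosure K σ {r 0 1 2})
      ≤ D.comap (mapTrees K f) :=
    Submodule.map₂_le.2 fun a ha b hb => (hS a).1 (hle ha) b hb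
  exact hmap hc

section PairMap

variable {E F G : Type*} [AddCommGroup E] [Module K E] [AddCommGroup F] [Module K F]
  [AddCommGroup G] [Module K G]

/-- The components of the pairing `Ψ`, followed by a map of generators. -/
def pairMap (f : E ⊗[K] F →ₗ[K] G) : E ⊗[K] E →ₗ[K] F ⊗[K] F →ₗ[K] G ⊗[K] G :=
  (TensorProduct.mk K (E ⊗[K] E) (F ⊗[K] F)).compr₂
    (TensorProduct.map f f ∘ₗ (TensorProduct.tensorTensorTensorComm K E E F F).toLinearMap)

theorem pairMap_tmul (f : E ⊗[K] F →ₗ[K] G) (μ ν : E) (μ' ν' : F) :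
    pairMap f (μ ⊗ₜ ν) (μ' ⊗ₜ ν') = f (μ ⊗ₜ μ') ⊗ₜ f (ν ⊗ₜ ν') :=
  rfl

theorem mapTrees_blackPairing_apply (f : E ⊗[K] F →ₗ[K] G) (a : Trees K E) (b : Trees K F)
    (u : Fin 3) : mapTrees K f (blackPairing E F a b) u = pairMap f (a u) (b u) :=
  rfl

end PairMap

theorem black_mem {P Q : BinQuad K} {a : Trees K P.E} {b : Trees K Q.E} (ha : a ∈ P.rel)
    (hb : b ∈ Q.rel) : blackPairing P.E Q.E a b ∈ (black P Q).rel :=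
  Submodule.apply_mem_map₂ _ ha hb

variable (K) in
/-- The relator of `Leib` with permuted arguments. -/
def leibPerm (i j k : Fin 3) : Trees K (Gens K 1) :=
  lm (gen K 0) (gen K 0) i j k - rm (gen K 0) (gen K 0) i j k - lm (gen K 0) (gen K 0) i k j

theorem isNatural_leibPerm : IsNatural K (opp K 1) (leibPerm K) :=
  ((isNatural_lm _ _).sub (isNatural_rm _ _)).sub (isNatural_lm _ _).flip

theorem leibPerm_mem (i j k : Fin 3) (h : Distinct i j k) : leibPerm K i j k ∈ (Leib K).rel :=
  isNatural_leibPerm.mem (Leib K).stable (subset_relClosure K _ _ rfl : leibRel K ∈ (Leib K).rel)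
    i j k h

theorem distinct_cases {p : Fin 3 → Fin 3 → Fin 3 → Prop} (h₀₁₂ : p 0 1 2) (h₀₂₁ : p 0 2 1)
    (h₁₀₂ : p 1 0 2) (h₁₂₀ : p 1 2 0) (h₂₀₁ : p 2 0 1) (h₂₁₀ : p 2 1 0) (i j k : Fin 3)
    (h : Distinct i j k) : p i j k := by
  fin_cases i <;> fin_cases j <;> fin_cases k <;> first | exact absurd h (by decide) | assumption

/-- An equivariant isomorphism of generators, which maps relators to relators and whose image of
the relators contains the generating relators, is an isomorphism onto a presented operad. -/
def presentIso {P : BinQuad K} {E : Type u} [AddCommGroup E] [Module K E] [Module.Finite K E]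
    {τ : E →ₗ[K] E} {hτ : ∀ x, τ (τ x) = x} {s : Set (Trees K E)} (e : P.E ≃ₗ[K] E)
    (he : ∀ x, e (P.τ x) = τ (e x))
    (h₁ : ∀ c ∈ P.rel, mapTrees K e.toLinearMap c ∈ relClosure K τ s)
    (h₂ : ∀ a ∈ s, ∃ c ∈ P.rel, mapTrees K e.toLinearMap c = a) :
    P ≅ BinQuad.present E τ hτ s where
  hom := { toLin := e.toLinearMap, comm := he, map_rel := h₁ }
  inv := BinQuad.homMk e.symm.toLinearMap
    (fun x => e.injective <| by
      have h := he (e.symm x)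
      rw [e.apply_symm_apply] at h
      rw [LinearEquiv.coe_coe, e.apply_symm_apply]
      exact h.symm)
    (fun a ha => by
      obtain ⟨c, hc, rfl⟩ := h₂ a ha
      rwa [← mapTrees_comp, e.symm_comp, mapTrees_id])
  hom_inv_id := BinQuad.Hom.ext e.symm_comp
  inv_hom_id := BinQuad.Hom.ext e.comp_symm

variable (K) in
/-- The generating relator of `Lie`. -/
def jacobi : Trees K K := fun _ => 1 ⊗ₜ 1

theorem lieOp_relator : leftComb K (-LinearMap.id) (1 : K) 1 0 1 2
    + leftComb K (-LinearMap.id) (1 : K) 1 1 2 0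
    + leftComb K (-LinearMap.id) (1 : K) 1 2 0 1 = jacobi K := by
  funext u
  fin_cases u <;> simp [leftComb, jacobi]

/-- The Jacobi relator is `1 ⊗ 1` in every copy, so pairing with it changes nothing: `Lie` behaves
as a unit for the black product. -/
theorem mapTrees_lid_jacobi (b : Trees K (Gens K 1)) :
    mapTrees K (TensorProduct.lid K (Gens K 1)).toLinearMap (blackPairing K (Gens K 1) (jacobi K) b)
      = b := by
  have h : pairMap (TensorProduct.lid K (Gens K 1)).toLinearMap (1 ⊗ₜ 1) = LinearMap.id := by
    refine TensorProduct.ext' fun x y => ?_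
    rw [pairMap_tmul]
    simp
  funext u
  rw [mapTrees_blackPairing_apply]
  exact LinearMap.congr_fun h (b u)

theorem jacobi_mem : jacobi K ∈ (LieOp K).rel := by
  have h := subset_relClosure K (-LinearMap.id : K →ₗ[K] K) _ (Set.mem_singleton
    (leftComb K (-LinearMap.id) (1 : K) 1 0 1 2 + leftComb K (-LinearMap.id) (1 : K) 1 1 2 0
      + leftComb K (-LinearMap.id) (1 : K) 1 2 0 1))
  rw [← lieOp_relator]
  exact h

/-- The twist by the sign representation cancels the antisymmetry of the bracket. -/
theorem lid_comm (e : K ⊗[K] Gens K 1) :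
    TensorProduct.lid K (Gens K 1)
        ((-TensorProduct.map (-LinearMap.id : K →ₗ[K] K) (opp K 1)) e)
      = opp K 1 (TensorProduct.lid K (Gens K 1) e) := by
  induction e using TensorProduct.induction_on with
  | zero => simp
  | add x y hx hy => simp only [map_add, hx, hy]
  | tmul x y => simp [TensorProduct.neg_tmul]

variable (K) in
/-- The isomorphism of generators underlying `Lie ● Leib ≅ Leib`. -/
abbrev lieBlackLeibEquiv : K ⊗[K] Gens K 1 ≃ₗ[K] Gens K 1 := TensorProduct.lid K (Gens K 1)

/-- The isomorphism `Lie ● Leib ≅ Leib`. -/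
def lieBlackLeibIso : black (LieOp K) (Leib K) ≅ Leib K :=
  presentIso (P := black (LieOp K) (Leib K)) (lieBlackLeibEquiv K)
    (lid_comm (K := K))
    (fun c hc => by
      refine map_relClosure_black_le (r := leibPerm K) opp_opp (lid_comm (K := K)) (Leib K).stable
        isNatural_leibPerm (fun i j k h => ?_) hc
      rw [lieOp_relator]
      have h' := leibPerm_mem (K := K) i j k h
      rw [← mapTrees_lid_jacobi (leibPerm K i j k)] at h'
      exact h')
    (by
      rintro _ rfl
      exact ⟨_, black_mem (P := LieOp K) (Q := Leib K) jacobi_mem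
        (leibPerm_mem 0 1 2 (by decide)), mapTrees_lid_jacobi _⟩)

end BlackProduct

/-! ### The black product of `Ass` and `Leib` -/

section AssBlackLeib

variable {K : Type u} [Field K]

variable (K) in
/-- The linear map which sends `(x y) ⊗ (x · y)` to `x ≺ y` and `(y x) ⊗ (x · y)` to `y ≻ x`. -/
def assBlackLeibLin : Gens K 1 ⊗[K] Gens K 1 →ₗ[K] Gens K 2 :=
  TensorProduct.lift <| LinearMap.mk₂ K
    -- The signs are forced by equivariance, since the transposition acts on the source by minus the
    -- tensor product of the two transpositions.
    (fun a l => ![((a 0).1 * (l 0).1, -((a 0).2 * (l 0).2)),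
      (-((a 0).1 * (l 0).2), (a 0).2 * (l 0).1)])
    (fun a a' l => by ext i <;> fin_cases i <;> simp <;> ring)
    (fun c a l => by ext i <;> fin_cases i <;> simp <;> ring)
    (fun a l l' => by ext i <;> fin_cases i <;> simp <;> ring)
    (fun c a l => by ext i <;> fin_cases i <;> simp <;> ring)

theorem assBlackLeibLin_tmul (a l : Gens K 1) :
    assBlackLeibLin K (a ⊗ₜ l) = ![((a 0).1 * (l 0).1, -((a 0).2 * (l 0).2)),
      (-((a 0).1 * (l 0).2), (a 0).2 * (l 0).1)] :=
  rfl

theorem assBlackLeibLin_gen_gen : assBlackLeibLin K (gen K 0 ⊗ₜ gen K 0) = gen K 0 := by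
  rw [assBlackLeibLin_tmul]
  ext i <;> fin_cases i <;> simp [gen]

theorem assBlackLeibLin_gen_opp :
    assBlackLeibLin K (gen K 0 ⊗ₜ opp K 1 (gen K 0)) = -gen K 1 := by
  rw [assBlackLeibLin_tmul]
  ext i <;> fin_cases i <;> simp [gen, opp]

theorem assBlackLeibLin_opp_gen :
    assBlackLeibLin K (opp K 1 (gen K 0) ⊗ₜ gen K 0) = opp K 2 (gen K 1) := by
  rw [assBlackLeibLin_tmul]
  ext i <;> fin_cases i <;> simp [gen, opp]

theorem assBlackLeibLin_opp_opp :
    assBlackLeibLin K (opp K 1 (gen K 0) ⊗ₜ opp K 1 (gen K 0)) = -opp K 2 (gen K 0) := by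
  rw [assBlackLeibLin_tmul]
  ext i <;> fin_cases i <;> simp [gen, opp]

theorem assBlackLeibLin_comm (e : Gens K 1 ⊗[K] Gens K 1) :
    assBlackLeibLin K ((-TensorProduct.map (opp K 1) (opp K 1)) e)
      = opp K 2 (assBlackLeibLin K e) := by
  induction e using TensorProduct.induction_on with
  | zero => simp
  | add x y hx hy => simp only [map_add, hx, hy]
  | tmul x y =>
    rw [LinearMap.neg_apply, map_neg, TensorProduct.map_tmul, assBlackLeibLin_tmul,
      assBlackLeibLin_tmul]
    ext i <;> fin_cases i <;> simp [opp]

variable (K) in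
/-- The isomorphism of generators underlying `Ass ● Leib ≅ diAss`. -/
def assBlackLeibEquiv : Gens K 1 ⊗[K] Gens K 1 ≃ₗ[K] Gens K 2 :=
  have hσ : ∀ e, (-TensorProduct.map (opp K 1) (opp K 1))
      ((-TensorProduct.map (opp K 1) (opp K 1)) e) = e := (black (Ass K) (Leib K)).τ_τ
  LinearEquiv.ofLinearMap (assBlackLeibLin K)
    (gensLift (-TensorProduct.map (opp K 1) (opp K 1))
      ![gen K 0 ⊗ₜ gen K 0, -(gen K 0 ⊗ₜ opp K 1 (gen K 0))])
    (by
      refine gens_hom_ext (fun i => ?_) fun i => ?_ <;>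
        simp only [LinearMap.comp_apply, LinearMap.id_apply, gensLift_opp _ hσ, gensLift_gen,
          assBlackLeibLin_comm] <;>
        fin_cases i <;> simp [assBlackLeibLin_gen_gen, assBlackLeibLin_gen_opp])
    (by
      refine TensorProduct.ext (gens_hom_ext (fun i => gens_hom_ext (fun j => ?_) fun j => ?_)
        fun i => gens_hom_ext (fun j => ?_) fun j => ?_) <;>
        obtain rfl := Subsingleton.elim i 0 <;> obtain rfl := Subsingleton.elim j 0 <;>
        simp [assBlackLeibLin_gen_gen, assBlackLeibLin_gen_opp, assBlackLeibLin_opp_gen,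
          assBlackLeibLin_opp_opp, gensLift_opp _ hσ, gensLift_gen, opp_opp])

/-- The associator lives in the copies 0 and 1 only, and every permuted Leibniz relator has one
monomial in each copy. Each of the six images is therefore, up to sign, a difference of two
monomials. The orders `1 0 2` and `1 2 0` give opposite results, which leaves five relators, as many
as the diassociative axioms. -/
theorem assBlackLeibLin_relator₀₁₂ :
    mapTrees K (assBlackLeibLin K) (blackPairing _ _ (assRel K) (leibPerm K 0 1 2))
      = lm (gen K 0) (gen K 0) 0 1 2 - rm (gen K 0) (gen K 0) 0 1 2 := by
  funext u
  rw [mapTrees_blackPairing_apply]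
  fin_cases u <;>
    simp [assRel, leibPerm, lm, rm, leftComb, rightComb, pairMap_tmul, assBlackLeibLin_gen_gen,
      assBlackLeibLin_opp_opp, TensorProduct.neg_tmul]

theorem assBlackLeibLin_relator₀₂₁ :
    mapTrees K (assBlackLeibLin K) (blackPairing _ _ (assRel K) (leibPerm K 0 2 1))
      = -(lm (gen K 0) (gen K 0) 0 1 2 - rm (gen K 0) (gen K 1) 0 1 2) := by
  funext u
  rw [mapTrees_blackPairing_apply]
  fin_cases u <;>
    simp [assRel, leibPerm, lm, rm, leftComb, rightComb, pairMap_tmul, assBlackLeibLin_gen_gen,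
      assBlackLeibLin_gen_opp, assBlackLeibLin_opp_opp, TensorProduct.neg_tmul,
      TensorProduct.tmul_neg]

theorem assBlackLeibLin_relator₁₀₂ :
    mapTrees K (assBlackLeibLin K) (blackPairing _ _ (assRel K) (leibPerm K 1 0 2))
      = -(lm (gen K 1) (gen K 0) 0 1 2 - rm (gen K 1) (gen K 0) 0 1 2) := by
  funext u
  rw [mapTrees_blackPairing_apply]
  fin_cases u <;>
    simp [assRel, leibPerm, lm, rm, leftComb, rightComb, pairMap_tmul, assBlackLeibLin_gen_gen,
      assBlackLeibLin_gen_opp, assBlackLeibLin_opp_gen, TensorProduct.tmul_neg]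

theorem assBlackLeibLin_relator₁₂₀ :
    mapTrees K (assBlackLeibLin K) (blackPairing _ _ (assRel K) (leibPerm K 1 2 0))
      = lm (gen K 1) (gen K 0) 0 1 2 - rm (gen K 1) (gen K 0) 0 1 2 := by
  funext u
  rw [mapTrees_blackPairing_apply]
  fin_cases u <;>
    simp [assRel, leibPerm, lm, rm, leftComb, rightComb, pairMap_tmul, assBlackLeibLin_gen_gen,
      assBlackLeibLin_gen_opp, assBlackLeibLin_opp_gen, TensorProduct.tmul_neg]

theorem assBlackLeibLin_relator₂₀₁ :
    mapTrees K (assBlackLeibLin K) (blackPairing _ _ (assRel K) (leibPerm K 2 0 1))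
      = lm (gen K 0) (gen K 1) 0 1 2 - rm (gen K 1) (gen K 1) 0 1 2 := by
  funext u
  rw [mapTrees_blackPairing_apply]
  fin_cases u <;>
    simp [assRel, leibPerm, lm, rm, leftComb, rightComb, pairMap_tmul, assBlackLeibLin_gen_gen,
      assBlackLeibLin_gen_opp, assBlackLeibLin_opp_gen, TensorProduct.neg_tmul,
      TensorProduct.tmul_neg]

theorem assBlackLeibLin_relator₂₁₀ :
    mapTrees K (assBlackLeibLin K) (blackPairing _ _ (assRel K) (leibPerm K 2 1 0))
      = -(lm (gen K 1) (gen K 1) 0 1 2 - rm (gen K 1) (gen K 1) 0 1 2) := by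
  funext u
  rw [mapTrees_blackPairing_apply]
  fin_cases u <;>
    simp [assRel, leibPerm, lm, rm, leftComb, rightComb, pairMap_tmul,
      assBlackLeibLin_gen_opp, assBlackLeibLin_opp_gen, TensorProduct.neg_tmul,
      TensorProduct.tmul_neg]

theorem assBlackLeibLin_relator (i j k : Fin 3) (h : Distinct i j k) :
    mapTrees K (assBlackLeibLin K) (blackPairing _ _ (assRel K) (leibPerm K i j k))
      ∈ relClosure K (opp K 2) (diAssRels K) := by
  have hr := subset_relClosure K (opp K 2) (diAssRels K)
  have h₁ := SetLike.mem_coe.1 (hr (Or.inl rfl))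
  have h₂ := SetLike.mem_coe.1 (hr (Or.inr (Or.inl rfl)))
  have h₃ := SetLike.mem_coe.1 (hr (Or.inr (Or.inr (Or.inl rfl))))
  have h₄ := SetLike.mem_coe.1 (hr (Or.inr (Or.inr (Or.inr (Or.inl rfl)))))
  have h₅ := SetLike.mem_coe.1 (hr (Or.inr (Or.inr (Or.inr (Or.inr rfl)))))
  -- Two of the images compare the ends of a chain of equalities, so the consecutive axioms are
  -- added: `(x ≺ y) ≺ z` with `x ≺ (y ≻ z)`, and `(x ≺ y) ≻ z` with `x ≻ (y ≻ z)`.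
  have h₁₂ := add_mem h₁ h₂
  have h₄₅ := add_mem h₄ h₅
  rw [sub_add_sub_cancel] at h₁₂ h₄₅
  revert i j k
  refine distinct_cases ?_ ?_ ?_ ?_ ?_ ?_
  · rw [assBlackLeibLin_relator₀₁₂]; exact h₁
  · rw [assBlackLeibLin_relator₀₂₁]; exact neg_mem h₁₂
  · rw [assBlackLeibLin_relator₁₀₂]; exact neg_mem h₃
  · rw [assBlackLeibLin_relator₁₂₀]; exact h₃
  · rw [assBlackLeibLin_relator₂₀₁]; exact h₄₅
  · rw [assBlackLeibLin_relator₂₁₀]; exact neg_mem h₅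

theorem assBlackLeib_mem {i j k : Fin 3} (h : Distinct i j k) :
    blackPairing _ _ (assRel K) (leibPerm K i j k) ∈ (black (Ass K) (Leib K)).rel :=
  black_mem (P := Ass K) (Q := Leib K) (subset_relClosure K (opp K 1) {assRel K} rfl)
    (leibPerm_mem i j k h)

/-- The isomorphism `Ass ● Leib ≅ diAss`. -/
def assBlackLeibIso : black (Ass K) (Leib K) ≅ DiAss K :=
  presentIso (P := black (Ass K) (Leib K)) (assBlackLeibEquiv K) assBlackLeibLin_comm
    (fun c hc => map_relClosure_black_le (r := leibPerm K) opp_opp assBlackLeibLin_comm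
      (DiAss K).stable isNatural_leibPerm assBlackLeibLin_relator hc)
    (by
      have h₀₁₂ := assBlackLeib_mem (K := K) (i := 0) (j := 1) (k := 2) (by decide)
      have h₀₂₁ := assBlackLeib_mem (K := K) (i := 0) (j := 2) (k := 1) (by decide)
      have h₁₂₀ := assBlackLeib_mem (K := K) (i := 1) (j := 2) (k := 0) (by decide)
      have h₂₀₁ := assBlackLeib_mem (K := K) (i := 2) (j := 0) (k := 1) (by decide)
      have h₂₁₀ := assBlackLeib_mem (K := K) (i := 2) (j := 1) (k := 0) (by decide)
      have key : ∀ a ∈ diAssRels K, ∃ c ∈ (black (Ass K) (Leib K)).rel,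
          mapTrees K (assBlackLeibLin K) c = a := by
        rintro _ (rfl | rfl | rfl | rfl | rfl)
        · exact ⟨_, h₀₁₂, assBlackLeibLin_relator₀₁₂⟩
        · refine ⟨_, neg_mem (add_mem h₀₁₂ h₀₂₁), (map_neg _ _).trans
            ((congrArg _ ((map_add _ _ _).trans
              (congrArg₂ _ assBlackLeibLin_relator₀₁₂ assBlackLeibLin_relator₀₂₁))).trans ?_)⟩
          abel
        · exact ⟨_, h₁₂₀, assBlackLeibLin_relator₁₂₀⟩
        · refine ⟨_, add_mem h₂₀₁ h₂₁₀, (map_add _ _ _).trans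
            ((congrArg₂ _ assBlackLeibLin_relator₂₀₁ assBlackLeibLin_relator₂₁₀).trans ?_)⟩
          abel
        · refine ⟨_, neg_mem h₂₁₀, (map_neg _ _).trans
            ((congrArg _ assBlackLeibLin_relator₂₁₀).trans ?_)⟩
          exact neg_neg _
      exact key)

end AssBlackLeib

/-! ### The black product of `Com` and `Leib` -/

section ComBlackLeib

variable {K : Type u} [Field K]

variable (K) in
/-- The involution of the span of an operation without symmetry and its opposite which changes the
sign of the opposite operation. -/
def negOpp : Gens K 1 →ₗ[K] Gens K 1 :=
  ((LinearMap.fst K K K).prod (-LinearMap.snd K K K)).compLeft (Fin 1)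

theorem negOpp_gen : negOpp K (gen K 0) = gen K 0 := by
  ext i <;> fin_cases i <;> simp [negOpp, gen]

/-- The product of `Com` is symmetric, so the transposition acts on the generators of the black
product by minus the exchange; this sign change absorbs the minus. -/
theorem negOpp_opp (e : Gens K 1) : negOpp K (opp K 1 e) = -opp K 1 (negOpp K e) := by
  ext i <;> simp [negOpp, opp]

variable (K) in
/-- The isomorphism of generators underlying `Com ● Leib ≅ Perm`. -/
def comBlackLeibEquiv : K ⊗[K] Gens K 1 ≃ₗ[K] Gens K 1 :=
  (TensorProduct.lid K (Gens K 1)).trans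
    (LinearEquiv.ofInvolutive (negOpp K) fun e => by ext i <;> simp [negOpp])

theorem comBlackLeibEquiv_tmul (c : K) (l : Gens K 1) :
    comBlackLeibEquiv K (c ⊗ₜ l) = c • negOpp K l :=
  map_smul (negOpp K) c l

theorem comBlackLeibEquiv_comm (e : K ⊗[K] Gens K 1) :
    comBlackLeibEquiv K ((-TensorProduct.map (LinearMap.id : K →ₗ[K] K) (opp K 1)) e)
      = opp K 1 (comBlackLeibEquiv K e) := by
  induction e using TensorProduct.induction_on with
  | zero => simp
  | add x y hx hy => simp only [map_add, hx, hy]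
  | tmul x y =>
    rw [LinearMap.neg_apply, map_neg, TensorProduct.map_tmul, comBlackLeibEquiv_tmul,
      comBlackLeibEquiv_tmul, negOpp_opp, map_smul, smul_neg, neg_neg, LinearMap.id_apply]

theorem comBlackLeibEquiv_gen : comBlackLeibEquiv K (1 ⊗ₜ gen K 0) = gen K 0 := by
  rw [comBlackLeibEquiv_tmul, negOpp_gen, one_smul]

theorem comBlackLeibEquiv_opp :
    comBlackLeibEquiv K (1 ⊗ₜ opp K 1 (gen K 0)) = -opp K 1 (gen K 0) := by
  rw [comBlackLeibEquiv_tmul, negOpp_opp, negOpp_gen, one_smul]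

variable (K) in
/-- The generating relator of `Com`. -/
def comRel : Trees K K :=
  leftComb K LinearMap.id (1 : K) 1 0 1 2 - rightComb K LinearMap.id (1 : K) 1 0 1 2

variable (K) in
/-- The relators `(x_i x_j) x_k - x_i (x_j x_k)`. -/
def assPerm (i j k : Fin 3) : Trees K (Gens K 1) :=
  lm (gen K 0) (gen K 0) i j k - rm (gen K 0) (gen K 0) i j k

variable (K) in
/-- The relators `(x_i x_j) x_k - x_i (x_k x_j)`. -/
def permPerm (i j k : Fin 3) : Trees K (Gens K 1) :=
  lm (gen K 0) (gen K 0) i j k - rm (gen K 0) (gen K 0) i k j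

theorem assPerm_mem (i j k : Fin 3) (h : Distinct i j k) : assPerm K i j k ∈ (PermOp K).rel :=
  ((isNatural_lm _ _).sub (isNatural_rm _ _)).mem (PermOp K).stable
    (subset_relClosure K _ _ (Or.inl rfl)) i j k h

theorem permPerm_mem (i j k : Fin 3) (h : Distinct i j k) : permPerm K i j k ∈ (PermOp K).rel := by
  have hr := subset_relClosure K (opp K 1)
    {assRel K, rm (gen K 0) (gen K 0) 0 1 2 - rm (gen K 0) (gen K 0) 0 2 1}
  have h₁ := add_mem (SetLike.mem_coe.1 (hr (Or.inl rfl))) (SetLike.mem_coe.1 (hr (Or.inr rfl)))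
  rw [assRel, sub_add_sub_cancel] at h₁
  exact ((isNatural_lm _ _).sub (isNatural_rm _ _).flip).mem (PermOp K).stable h₁ i j k h

variable (K) in
/-- The images in `Perm` of the relators of `Com ● Leib`. -/
def comLeibRel (i j k : Fin 3) : Trees K (Gens K 1) :=
  mapTrees K (comBlackLeibEquiv K).toLinearMap
    (blackPairing K (Gens K 1) (comRel K) (leibPerm K i j k))

theorem comLeibRel_apply (i j k u : Fin 3) :
    comLeibRel K i j k u
      = pairMap (comBlackLeibEquiv K).toLinearMap (comRel K u) (leibPerm K i j k u) :=
  rfl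

/-- As for `Ass`, the relator of `Com` has only the components 0 and 1. In the third and fourth
images the common term `y (z x)` cancels, leaving `(y z) x - (y x) z` up to sign. -/
theorem comLeibRel_eq :
    comLeibRel K 0 1 2 = assPerm K 0 1 2 ∧ comLeibRel K 0 2 1 = -permPerm K 0 1 2 ∧
      comLeibRel K 1 0 2 = assPerm K 1 2 0 - permPerm K 1 0 2 ∧
      comLeibRel K 1 2 0 = permPerm K 1 0 2 - assPerm K 1 2 0 ∧
      comLeibRel K 2 0 1 = -permPerm K 2 1 0 ∧ comLeibRel K 2 1 0 = assPerm K 2 1 0 := by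
  refine ⟨?_, ?_, ?_, ?_, ?_, ?_⟩ <;> funext u <;> fin_cases u <;>
    simp [comLeibRel_apply, comRel, assPerm, permPerm, leibPerm, lm, rm, leftComb, rightComb,
      pairMap_tmul, comBlackLeibEquiv_gen, comBlackLeibEquiv_opp, TensorProduct.neg_tmul,
      TensorProduct.tmul_neg]

theorem comLeibRel_mem (i j k : Fin 3) (h : Distinct i j k) :
    comLeibRel K i j k ∈ (PermOp K).rel := by
  obtain ⟨h₁, h₂, h₃, h₄, h₅, h₆⟩ := comLeibRel_eq (K := K)
  revert i j k
  refine distinct_cases ?_ ?_ ?_ ?_ ?_ ?_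
  · rw [h₁]; exact assPerm_mem _ _ _ (by decide)
  · rw [h₂]; exact neg_mem (permPerm_mem _ _ _ (by decide))
  · rw [h₃]; exact sub_mem (assPerm_mem _ _ _ (by decide)) (permPerm_mem _ _ _ (by decide))
  · rw [h₄]; exact sub_mem (permPerm_mem _ _ _ (by decide)) (assPerm_mem _ _ _ (by decide))
  · rw [h₅]; exact neg_mem (permPerm_mem _ _ _ (by decide))
  · rw [h₆]; exact assPerm_mem _ _ _ (by decide)

theorem comBlackLeib_mem {i j k : Fin 3} (h : Distinct i j k) :
    blackPairing K (Gens K 1) (comRel K) (leibPerm K i j k) ∈ (black (Com K) (Leib K)).rel :=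
  black_mem (P := Com K) (Q := Leib K)
    (subset_relClosure K (LinearMap.id : K →ₗ[K] K) _ (Set.mem_singleton (comRel K)))
    (leibPerm_mem i j k h)

/-- The isomorphism `Com ● Leib ≅ Perm`. -/
def comBlackLeibIso : black (Com K) (Leib K) ≅ PermOp K :=
  presentIso (P := black (Com K) (Leib K)) (comBlackLeibEquiv K)
    (comBlackLeibEquiv_comm (K := K))
    (fun c hc => map_relClosure_black_le (r := leibPerm K) opp_opp
      (comBlackLeibEquiv_comm (K := K)) (PermOp K).stable isNatural_leibPerm comLeibRel_mem hc)
    (by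
      obtain ⟨h₁, h₂, -⟩ := comLeibRel_eq (K := K)
      have h₀₁₂ := comBlackLeib_mem (K := K) (i := 0) (j := 1) (k := 2) (by decide)
      have h₀₂₁ := comBlackLeib_mem (K := K) (i := 0) (j := 2) (k := 1) (by decide)
      rintro _ (rfl | rfl)
      · exact ⟨_, h₀₁₂, h₁⟩
      · refine ⟨_, neg_mem (add_mem h₀₁₂ h₀₂₁), (map_neg _ _).trans
          ((congrArg _ ((map_add _ _ _).trans (congrArg₂ _ h₁ h₂))).trans ?_)⟩
        rw [assPerm, permPerm]
        abel)

end ComBlackLeib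

/-! ### Commutativity of the squares -/

section ChapotonSquare

variable (K : Type u) [Field K]

variable {K} in
/-- Morphisms from a black product with `Leib` are determined by their values on the products with
the generating product of `Leib`. -/
theorem black_leib_hom_ext {P Q : BinQuad K} {f g : black P (Leib K) ⟶ Q}
    (h : ∀ x : P.E, BinQuad.Hom.toLin f (x ⊗ₜ leibDot K) = BinQuad.Hom.toLin g (x ⊗ₜ leibDot K)) :
    f = g := by
  -- A generator paired with the opposite product is the transpose of one paired with the product,
  -- so equivariance covers it.
  have hτ : ∀ x : P.E, (black P (Leib K)).τ (-(P.τ x ⊗ₜ leibDot K))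
      = x ⊗ₜ (Leib K).τ (leibDot K) := by
    intro x
    change (-TensorProduct.map P.τ (Leib K).τ) (-(P.τ x ⊗ₜ leibDot K)) = _
    rw [map_neg, LinearMap.neg_apply, neg_neg, TensorProduct.map_tmul, P.τ_τ]
  have h' : ∀ x : P.E, BinQuad.Hom.toLin f (x ⊗ₜ (Leib K).τ (leibDot K))
      = BinQuad.Hom.toLin g (x ⊗ₜ (Leib K).τ (leibDot K)) := by
    intro x
    have hn : BinQuad.Hom.toLin f (-(P.τ x ⊗ₜ leibDot K))
        = BinQuad.Hom.toLin g (-(P.τ x ⊗ₜ leibDot K)) :=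
      (map_neg (BinQuad.Hom.toLin f) _).trans
        ((congrArg _ (h (P.τ x))).trans (map_neg (BinQuad.Hom.toLin g) _).symm)
    exact (congrArg (BinQuad.Hom.toLin f) (hτ x)).symm.trans <| (BinQuad.Hom.comm f _).trans <|
      (congrArg Q.τ hn).trans <| (BinQuad.Hom.comm g _).symm.trans <|
        congrArg (BinQuad.Hom.toLin g) (hτ x)
  refine BinQuad.Hom.ext (TensorProduct.ext (LinearMap.ext fun x => ?_))
  refine gens_hom_ext (K := K) (n := 1) (fun i => ?_) fun i => ?_
  · obtain rfl := Subsingleton.elim i 0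
    exact h x
  · obtain rfl := Subsingleton.elim i 0
    exact h' x

/-- Both composites send the bracket paired with `x · y` to `x ≺ y - y ≻ x`, since `x y` contributes
`x ≺ y` and `y x` contributes `y ≻ x`. -/
theorem lieToAss_black_leib :
    blackMap (lieToAss K) (Leib K) ≫ assBlackLeibIso.hom
      = lieBlackLeibIso.hom ≫ leibToDiAss K := by
  refine black_leib_hom_ext fun x => ?_
  have key : ∀ x : K, assBlackLeibLin K
      (LinearMap.toSpanSingleton K (Gens K 1) (gen K 0 - opp K 1 (gen K 0)) x ⊗ₜ gen K 0)
      = gensLift (opp K 2) (fun _ : Fin 1 => gen K 0 - opp K 2 (gen K 1))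
        (TensorProduct.lid K (Gens K 1) (x ⊗ₜ gen K 0)) := by
    intro x
    rw [TensorProduct.lid_tmul, map_smul, gensLift_gen, LinearMap.toSpanSingleton_apply,
      ← TensorProduct.smul_tmul', map_smul, TensorProduct.sub_tmul, map_sub,
      assBlackLeibLin_gen_gen, assBlackLeibLin_opp_gen]
  exact key x

/-- Both composites send `x y` and `y x`, paired with `x · y`, to `x ⋆ y`: on one side by
commutativity, on the other because `x ≺ y` and `y ≻ x` have this common image. -/
theorem assToCom_black_leib :
    blackMap (assToCom K) (Leib K) ≫ comBlackLeibIso.hom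
      = assBlackLeibIso.hom ≫ diAssToPerm K := by
  refine black_leib_hom_ext fun x => ?_
  have hid : ∀ x : K, (LinearMap.id : K →ₗ[K] K) ((LinearMap.id : K →ₗ[K] K) x) = x := fun _ => rfl
  have key : (comBlackLeibEquiv K).toLinearMap
        ∘ₗ (TensorProduct.mk K K (Gens K 1)).flip (gen K 0)
        ∘ₗ gensLift (LinearMap.id : K →ₗ[K] K) (fun _ : Fin 1 => (1 : K))
      = gensLift (opp K 1) ![gen K 0, opp K 1 (gen K 0)] ∘ₗ assBlackLeibLin K
        ∘ₗ (TensorProduct.mk K (Gens K 1) (Gens K 1)).flip (gen K 0) := by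
    refine gens_hom_ext (fun i => ?_) fun i => ?_ <;> obtain rfl := Subsingleton.elim i 0 <;>
      simp [gensLift_gen, gensLift_opp _ hid, gensLift_opp _ (opp_opp (K := K) (n := 1)),
        comBlackLeibEquiv_gen, assBlackLeibLin_gen_gen, assBlackLeibLin_opp_gen, opp_opp]
  exact LinearMap.congr_fun key x

end ChapotonSquare

end BinaryOperad

theorem mainTheorem6 (K : Type u) [Field K] :
    -- `Ass_●(Leib) = diAss`
    (∃ Φ : AlgType.Iso (assBullet.{u, v} (Leib K)) (algType.{u, v} (DiAss K)),
      ∀ (V : Type v) [AddCommGroup V] [Module K V] (S : AssBulletStr (Leib K) V) (x y : V),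
        Alg.op (Φ.equiv V S) (diPrec K) x y = S.prec (leibDot K) x y ∧
        Alg.op (Φ.equiv V S) (diSucc K) x y = S.succ (leibDot K) x y) ∧
    -- `Com_●(Leib) = Perm`
    (∃ Φ : AlgType.Iso (comBullet.{u, v} (Leib K)) (algType.{u, v} (PermOp K)),
      ∀ (V : Type v) [AddCommGroup V] [Module K V] (S : ComBulletStr (Leib K) V) (x y : V),
        Alg.op (Φ.equiv V S) (permDot K) x y = S.prec (leibDot K) x y ∧
        Alg.op (Φ.equiv V S) (permDot K) x y = S.succ (leibDot K) y x) ∧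
    -- the presentation of `preLie_●(Leib)`
    (∃ Φ : AlgType.Iso (preLieBullet.{u, v} (Leib K)) (algType.{u, v} (PreLieLeib K)),
      ∀ (V : Type v) [AddCommGroup V] [Module K V] (S : PreLieBulletStr (Leib K) V) (x y : V),
        Alg.op (Φ.equiv V S) (plPrec K) x y = preLieBulletPrec S (leibDot K) x y ∧
        Alg.op (Φ.equiv V S) (plSucc K) x y = preLieBulletSucc S (leibDot K) x y) ∧
    relClosure K (opp K 2) (preLieLeibRels K) = relClosure K (opp K 2) (preLieLeibRels' K) ∧
    -- the bottom row `Leib → diAss → Perm` is the black product of `Lie → Ass → Com` with `Leib`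
    (∃ (i₁ : black (LieOp K) (Leib K) ≅ Leib K) (i₂ : black (Ass K) (Leib K) ≅ DiAss K)
      (i₃ : black (Com K) (Leib K) ≅ PermOp K),
      blackMap (lieToAss K) (Leib K) ≫ i₂.hom = i₁.hom ≫ leibToDiAss K ∧
      blackMap (assToCom K) (Leib K) ≫ i₃.hom = i₂.hom ≫ diAssToPerm K) := by
  refine ⟨⟨assBulletLeibIso, ?_⟩, ⟨comBulletLeibIso, ?_⟩, ⟨preLieBulletLeibIso, ?_⟩,
    relClosure_preLieLeibRels, lieBlackLeibIso, assBlackLeibIso, comBlackLeibIso,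
    lieToAss_black_leib K, assToCom_black_leib K⟩
  · intro V _ _ S x y
    exact ⟨assBulletLeibIso_prec S x y, assBulletLeibIso_succ S x y⟩
  · intro V _ _ S x y
    exact ⟨comBulletLeibIso_prec S x y, comBulletLeibIso_succ S x y⟩
  · intro V _ _ S x y
    exact ⟨preLieBulletLeibIso_prec S x y, preLieBulletLeibIso_succ S x y⟩
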